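/- The line graph $L(H)$ of a graph $H$ has the edges of $H$ as its vertices, two of them being adjacent if they are distinct and share an end. A graph $G$ contains a graph $K$ as an immersion if there are an injective map $\varphi\colon V(K)\to V(G)$ and, for every edge $uv\in E(K)$, a path $P_{uv}$ in $G$ with ends $\varphi(u)$ and $\varphi(v)$, such that the paths $P_{uv}$ ($uv\in E(K)$) are pairwise edge-disjoint. The vertices in $\varphi(V(K))$ are called terminals. The immersion is strong if no terminal is an interior vertex of any of the paths $P_{uv}$, and totally odd if every path $P_{uv}$ has odd length. Theorem. Let $H$ be a finite simple graph, let $G=L(H)$ be its line graph, and let $\chi(G)$ be the chromatic number of $G$. Then $G$ contains the complete graph $K_{\chi(G)}$ as a totally odd strong immersion. -/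

import Mathlib

namespace SimpleGraph

/-- An immersion of a graph `K` in a graph `G`: an injection of the vertices of `K` into the
vertices of `G` (its values are the terminals) and, for every edge `uv` of `K`, a path of `G`
between the images of `u` and `v`, such that paths of distinct edges are edge-disjoint.
The path of an edge is recorded in both directions of traversal; `path_symm` says that the two
records are the same path. -/
structure Immersion {U V : Type*} (K : SimpleGraph U) (G : SimpleGraph V) where
  terminal : U → V
  terminal_injective : Function.Injective terminal
  path : ∀ {u v : U}, K.Adj u v → G.Walk (terminal u) (terminal v)
  isPath : ∀ {u v : U} (h : K.Adj u v), (path h).IsPath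
  path_symm : ∀ {u v : U} (h : K.Adj u v), path h.symm = (path h).reverse
  edges_disjoint : ∀ {u v u' v' : U} (h : K.Adj u v) (h' : K.Adj u' v'),
    s(u, v) ≠ s(u', v') → (path h).edges.Disjoint (path h').edges

namespace Immersion

variable {U V : Type*} {K : SimpleGraph U} {G : SimpleGraph V}

/-- No terminal is an interior vertex of one of the paths: a terminal lying on the path of `uv`
is one of the two ends of that path. -/
def IsStrong (I : Immersion K G) : Prop :=
  ∀ {u v : U} (h : K.Adj u v) (w : U), I.terminal w ∈ (I.path h).support →
    I.terminal w = I.terminal u ∨ I.terminal w = I.terminal v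

/-- All the paths have odd length. -/
def IsTotallyOdd (I : Immersion K G) : Prop :=
  ∀ {u v : U} (h : K.Adj u v), Odd (I.path h).length

end Immersion

/-- `G` contains `K` as a totally odd strong immersion. -/
def ContainsTotallyOddStrongImmersion {U V : Type*} (G : SimpleGraph V) (K : SimpleGraph U) :
    Prop :=
  ∃ I : Immersion K G, I.IsStrong ∧ I.IsTotallyOdd

end SimpleGraph

/-! Let t be the chromatic number of L(H). A vertex of degree at least t gives a clique of size t in
L(H), so let t = k + 1 with all degrees at most k. Then H has no proper edge-colouring with k
colours, and some subgraph is minimal with this property (`IsEdgeCritical`). It suffices to work in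
that subgraph, since its line graph embeds in L(H). The case k = 0 is impossible, and so is k = 1 by
the next paragraph; for k = 2 an odd closed walk in L(H) yields the triangle. Let k ≥ 3.

Colouring. By Kempe changes every nonisolated vertex of a critical graph has, besides any given
vertex, a neighbour of degree k (`IsEdgeCritical.exists_adj_degree_eq`), hence two such neighbours.
Also, two vertices of degree two never have the same neighbours (`IsEdgeCritical.eq_of_adj_iff`).

Connectivity. Uncrossing smallest cuts gives a smallest cut, between two vertices of degree k, with
only one vertex of degree k on one side. By the colouring result at least k edges leave that side.
With Menger's theorem there are vertices u ≠ v of degree k joined by k edge-disjoint paths P_i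
(`IsEdgeCritical.exists_paths`).

Immersion. The terminals are the k edges at u, which form a clique of L(H), and the last edge f of
one path P_j. The edges of P_i, followed by f if i ≠ j, form a path of L(H) from the first edge of
P_i to f. Its length is |P_i| if i ≠ j, and |P_j| - 1 if i = j. If this is even, a detour corrects
it: between two consecutive edges of P_i at an interior vertex x, a third edge at x is inserted. The
result is edge-disjoint if different paths take their detours at different vertices
(`ContainsTotallyOddStrongImmersion.of_edgeDisjoint_paths`).

Detours. The detour vertex is the first vertex of degree at least three after u, which is the second
or third vertex of the path. If as few P_i as possible have even length, even paths have different
detour vertices: otherwise exchanging two tails makes two even paths odd, or two vertices of degree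
two have the same neighbours (`IsEdgeCritical.detourVertex_injOn`). At most one even path has no
room for a detour, and it is taken as P_j, which needs none. -/

namespace SimpleGraph

open Finset

/-! ### Kempe changes -/

section Coloring

variable {V C : Type*}

/-- `c` restricts to a proper edge-colouring of `G` with colours in `S`. -/
def IsEdgeColoring (G : SimpleGraph V) (S : Finset C) (c : Sym2 V → C) : Prop :=
  (∀ ⦃v w⦄, G.Adj v w → c s(v, w) ∈ S) ∧
    ∀ ⦃v a b⦄, G.Adj v a → G.Adj v b → c s(v, a) = c s(v, b) → a = b

/-- In a graph of maximum degree at most two, a connected component has at most two vertices of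
degree at most one. -/
theorem ConnectedComponent.card_le_two_of_degree_le_one [Fintype V] (K : SimpleGraph V)
    [DecidableRel K.Adj] (D : K.ConnectedComponent) (hK : ∀ v, K.degree v ≤ 2) (T : Finset V)
    (hT : ∀ v ∈ T, v ∈ D.supp ∧ K.degree v ≤ 1) : #T ≤ 2 := by
  classical
  have hconn : D.toSimpleGraph.Connected := D.connected_toSimpleGraph
  -- A connected graph on n vertices has degree sum at least 2n - 2, whereas here it is at most 2n -
  -- #T.
  have h1 := hconn.card_vert_le_card_edgeSet_add_one
  have h2 := D.toSimpleGraph.sum_degrees_eq_twice_card_edges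
  rw [Nat.card_eq_fintype_card, Nat.card_eq_fintype_card, ← edgeFinset_card] at h1
  have h3 : ∀ v : D, D.toSimpleGraph.degree v + (if v.1 ∈ T then 1 else 0) ≤ 2 := by
    intro v
    have hle : D.toSimpleGraph.degree v ≤ K.degree v.1 := by
      rw [← card_neighborFinset_eq_degree, ← card_neighborFinset_eq_degree]
      refine card_le_card_of_injOn (fun w => w.1) (fun w hw => ?_) (fun a _ b _ h => Subtype.ext h)
      simp only [coe_neighborFinset, mem_neighborSet] at hw ⊢
      exact hw
    split_ifs with h
    · have := (hT _ h).2; omega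
    · have := hK v.1; omega
  have h4 := sum_le_sum (fun v (_ : v ∈ (univ : Finset D)) => h3 v)
  rw [sum_add_distrib, h2, sum_const, card_univ, smul_eq_mul] at h4
  have h5 : #T ≤ ∑ v : D, (if v.1 ∈ T then 1 else 0) := by
    rw [← sum_filter, sum_const, smul_eq_mul, mul_one]
    refine card_le_card_of_surjOn (fun w => w.1) ?_
    intro v hv
    exact ⟨⟨v, (hT v hv).1⟩, by simpa using hv, rfl⟩
  omega

variable [DecidableEq C]

open Classical in
/-- Exchange the colours `i` and `j` on the edges that meet `D`. -/
noncomputable def kempeSwap (c : Sym2 V → C) (i j : C) (D : Set V) (e : Sym2 V) : C :=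
  if ∃ v ∈ e, v ∈ D then Equiv.swap i j (c e) else c e

theorem kempeSwap_of_mem (c : Sym2 V → C) (i j : C) {D : Set V} {v : V} (hv : v ∈ D) (w : V) :
    kempeSwap c i j D s(v, w) = Equiv.swap i j (c s(v, w)) :=
  if_pos ⟨v, by simp, hv⟩

/-- An edge from outside `D` that meets `D` has neither colour `i` nor colour `j`, since `D` is
closed under edges of these colours; so the exchange leaves it alone. -/
theorem kempeSwap_of_notMem {G : SimpleGraph V} {c : Sym2 V → C} {i j : C} {D : Set V}
    (hD : ∀ ⦃u w⦄, u ∈ D → G.Adj u w → c s(u, w) = i ∨ c s(u, w) = j → w ∈ D) {v w : V}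
    (hv : v ∉ D) (h : G.Adj v w) : kempeSwap c i j D s(v, w) = c s(v, w) := by
  rw [kempeSwap]
  split_ifs with h'
  · obtain ⟨x, hx, hxD⟩ := h'
    rcases Sym2.mem_iff.1 hx with rfl | rfl
    · exact absurd hxD hv
    · have : ¬(c s(v, x) = i ∨ c s(v, x) = j) := fun hc =>
        hv (hD hxD h.symm (by rwa [Sym2.eq_swap]))
      push Not at this
      exact Equiv.swap_apply_of_ne_of_ne this.1 this.2
  · rfl

theorem IsEdgeColoring.kempeSwap {G : SimpleGraph V} {S : Finset C} {c : Sym2 V → C}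
    (hc : G.IsEdgeColoring S c) {i j : C} (hi : i ∈ S) (hj : j ∈ S) {D : Set V}
    (hD : ∀ ⦃u w⦄, u ∈ D → G.Adj u w → c s(u, w) = i ∨ c s(u, w) = j → w ∈ D) :
    G.IsEdgeColoring S (SimpleGraph.kempeSwap c i j D) := by
  refine ⟨fun v w h => ?_, fun v a b ha hb h => ?_⟩
  · by_cases hv : v ∈ D
    · rw [kempeSwap_of_mem c i j hv, Equiv.swap_apply_def]
      split_ifs
      exacts [hj, hi, hc.1 h]
    · rw [kempeSwap_of_notMem hD hv h]
      exact hc.1 h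
  · by_cases hv : v ∈ D
    · rw [kempeSwap_of_mem c i j hv, kempeSwap_of_mem c i j hv] at h
      exact hc.2 ha hb ((Equiv.swap i j).injective h)
    · rw [kempeSwap_of_notMem hD hv ha, kempeSwap_of_notMem hD hv hb] at h
      exact hc.2 ha hb h

/-- The number of vertices of `N` at which the colour `i` is available. -/
def availCard (N : Finset V) (A : V → Finset C) (i : C) : ℕ := #{u ∈ N | i ∈ A u}

/-- If the colour `i` is available at three or more vertices and `j` at none, then a Kempe change
makes `j` available somewhere, `i` remaining available somewhere. -/
theorem exists_kempe_change [Fintype V] [DecidableEq V] {G : SimpleGraph V} {S : Finset C}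
    {c : Sym2 V → C}
    (hc : G.IsEdgeColoring S c) {N : Finset V} {A : V → Finset C}
    (hA : ∀ u ∈ N, A u ⊆ S ∧ ∀ w, G.Adj u w → c s(u, w) ∉ A u) {i j : C} (hi : i ∈ S) (hj : j ∈ S)
    (h3 : 3 ≤ availCard N A i) (h0 : availCard N A j = 0) :
    ∃ (c' : Sym2 V → C) (A' : V → Finset C), G.IsEdgeColoring S c' ∧
      (∀ u ∈ N, A' u ⊆ S ∧ ∀ w, G.Adj u w → c' s(u, w) ∉ A' u) ∧ (∀ u, #(A' u) = #(A u)) ∧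
      availCard N A' i ≠ 0 ∧ availCard N A' j ≠ 0 ∧
      ∀ l, l ≠ i → l ≠ j → availCard N A' l = availCard N A l := by
  classical
  have hij : i ≠ j := by rintro rfl; omega
  obtain ⟨u, hu⟩ : ({u ∈ N | i ∈ A u} : Finset V).Nonempty := card_pos.1 (by
    rw [availCard] at h3; omega)
  let K : SimpleGraph V :=
    { Adj := fun v w => G.Adj v w ∧ (c s(v, w) = i ∨ c s(v, w) = j)
      symm := ⟨fun v w h => ⟨h.1.symm, by rw [Sym2.eq_swap]; exact h.2⟩⟩
      loopless := ⟨fun v h => G.loopless.irrefl v h.1⟩ }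
  let D := K.connectedComponentMk u
  have hD : ∀ ⦃u w⦄, u ∈ D.supp → G.Adj u w → c s(u, w) = i ∨ c s(u, w) = j → w ∈ D.supp := by
    intro a b ha hab hcol
    have hadj : K.Adj a b := ⟨hab, hcol⟩
    rw [ConnectedComponent.mem_supp_iff] at ha ⊢
    rw [← ha]
    exact (ConnectedComponent.sound hadj.reachable).symm
  have hdeg : ∀ v, K.degree v ≤ 2 := by
    intro v
    rw [← card_neighborFinset_eq_degree]
    calc #(K.neighborFinset v) ≤ #({i, j} : Finset C) := by
          refine card_le_card_of_injOn (fun w => c s(v, w)) (fun w hw => ?_) ?_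
          · simp only [coe_neighborFinset, mem_neighborSet] at hw
            simpa using hw.2
          · intro a ha b hb h
            simp only [coe_neighborFinset, mem_neighborSet] at ha hb
            exact hc.2 ha.1 hb.1 h
      _ ≤ 2 := card_le_two
  -- Where `i` is available, only an edge of colour `j` can occur in `K`. So the component `D`
  -- contains at most two such vertices, and at least one of the three or more lies outside `D`,
  -- where `i` stays available.
  have hdeg1 : ∀ v ∈ N, i ∈ A v → K.degree v ≤ 1 := by
    intro v hv hiv
    rw [← card_neighborFinset_eq_degree]
    calc #(K.neighborFinset v) ≤ #({j} : Finset C) := by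
          refine card_le_card_of_injOn (fun w => c s(v, w)) (fun w hw => ?_) ?_
          · simp only [coe_neighborFinset, mem_neighborSet] at hw
            have := (hA v hv).2 w hw.1
            rcases hw.2 with h | h
            · rw [h] at this; exact absurd hiv this
            · simpa using h
          · intro a ha b hb h
            simp only [coe_neighborFinset, mem_neighborSet] at ha hb
            exact hc.2 ha.1 hb.1 h
      _ ≤ 1 := by simp
  have hcard : #({v ∈ N | i ∈ A v ∧ v ∈ D.supp} : Finset V) ≤ 2 := by
    refine ConnectedComponent.card_le_two_of_degree_le_one K D hdeg _ fun v hv => ?_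
    rw [mem_filter] at hv
    exact ⟨hv.2.2, hdeg1 v hv.1 hv.2.1⟩
  rw [mem_filter] at hu
  refine ⟨SimpleGraph.kempeSwap c i j D.supp,
    fun v => if v ∈ D.supp then (A v).map (Equiv.swap i j).toEmbedding else A v,
    hc.kempeSwap hi hj hD, ?_, ?_, ?_, ?_, ?_⟩
  · intro v hv
    by_cases hvD : v ∈ D.supp
    · simp only [if_pos hvD]
      refine ⟨fun l hl => ?_, fun w hw => ?_⟩
      · obtain ⟨m, hm, rfl⟩ := mem_map.1 hl
        simp only [Equiv.coe_toEmbedding, Equiv.swap_apply_def]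
        split_ifs
        exacts [hj, hi, (hA v hv).1 hm]
      · rw [kempeSwap_of_mem c i j hvD]
        intro h
        obtain ⟨m, hm, h⟩ := mem_map.1 h
        rw [Equiv.coe_toEmbedding] at h
        rw [(Equiv.swap i j).injective h] at hm
        exact (hA v hv).2 w hw hm
    · simp only [if_neg hvD]
      refine ⟨(hA v hv).1, fun w hw => ?_⟩
      rw [kempeSwap_of_notMem hD hvD hw]
      exact (hA v hv).2 w hw
  · intro v
    dsimp only
    split_ifs <;> simp
  · intro h
    rw [availCard, card_eq_zero, filter_eq_empty_iff] at h
    have hsub : ({u ∈ N | i ∈ A u} : Finset V) ⊆ {v ∈ N | i ∈ A v ∧ v ∈ D.supp} := by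
      intro v hv
      rw [mem_filter] at hv ⊢
      refine ⟨hv.1, hv.2, ?_⟩
      by_contra hvD
      have := h hv.1
      rw [if_neg hvD] at this
      exact this hv.2
    have := card_le_card hsub
    rw [availCard] at h3
    omega
  · intro h
    rw [availCard, card_eq_zero, filter_eq_empty_iff] at h
    have := h hu.1
    have huD : u ∈ D.supp := rfl
    rw [if_pos huD] at this
    exact this (mem_map.2 ⟨i, hu.2, by simp⟩)
  · intro l hli hlj
    rw [availCard, availCard]
    congr 1
    refine filter_congr fun v _ => ?_
    split_ifs
    · rw [mem_map]
      constructor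
      · rintro ⟨m, hm, h⟩
        rw [Equiv.coe_toEmbedding, Equiv.swap_apply_eq_iff,
          Equiv.swap_apply_of_ne_of_ne hli hlj] at h
        rwa [← h]
      · exact fun hl => ⟨l, hl, Equiv.swap_apply_of_ne_of_ne hli hlj⟩
    · rfl

end Coloring

end SimpleGraph

namespace SimpleGraph

open Finset

/-! ### Distinct missing colours at the neighbours of a deleted vertex -/

section Coloring

variable {V C : Type*} [DecidableEq C]

theorem sum_availCard [DecidableEq V] {S : Finset C} {N : Finset V} {A : V → Finset C}
    (hA : ∀ u ∈ N, A u ⊆ S) : ∑ i ∈ S, availCard N A i = ∑ u ∈ N, #(A u) := by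
  have := sum_card_bipartiteAbove_eq_sum_card_bipartiteBelow (s := N) (t := S)
    (fun u i => i ∈ A u)
  rw [eq_comm]
  convert this using 2 with u hu
  rw [bipartiteAbove]
  congr 1
  · ext i
    simpa using fun h => hA u hu h
  · rfl

/-- By Kempe changes one may arrange that some colour is available at exactly one vertex. -/
theorem exists_availCard_eq_one [Fintype V] [DecidableEq V] {G : SimpleGraph V} {S : Finset C}
    {N : Finset V} (m : ℕ) :
    ∀ {c : Sym2 V → C} {A : V → Finset C}, G.IsEdgeColoring S c →
    (∀ u ∈ N, A u ⊆ S ∧ ∀ w, G.Adj u w → c s(u, w) ∉ A u) →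
    Odd (∑ u ∈ N, #(A u)) → ∑ u ∈ N, #(A u) < 2 * #S →
    #{i ∈ S | availCard N A i = 0} < m →
    ∃ (c' : Sym2 V → C) (A' : V → Finset C), G.IsEdgeColoring S c' ∧
      (∀ u ∈ N, A' u ⊆ S ∧ ∀ w, G.Adj u w → c' s(u, w) ∉ A' u) ∧ (∀ u, #(A' u) = #(A u)) ∧
      ∃ i ∈ S, availCard N A' i = 1 := by
  induction m with
  | zero => intro c A _ _ _ _ hm; exact absurd hm (Nat.not_lt_zero _)
  | succ m ih =>
    intro c A hc hA hodd hlt hm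
    by_cases h1 : ∃ i ∈ S, availCard N A i = 1
    · exact ⟨c, A, hc, hA, fun _ => rfl, h1⟩
    push Not at h1
    have hsum := sum_availCard fun u hu => (hA u hu).1
    -- If every colour were available at least twice, the sum would be at least 2 * #S; if all
    -- counts were 0 or 2, it would be even. The Kempe change for the resulting pair lowers the
    -- number of colours available nowhere.
    obtain ⟨j, hj, hj0⟩ : ∃ j ∈ S, availCard N A j = 0 := by
      by_contra! h
      have : ∑ i ∈ S, 2 ≤ ∑ i ∈ S, availCard N A i := sum_le_sum fun i hi => by
        have := h1 i hi; have := h i hi; omega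
      rw [sum_const, smul_eq_mul] at this
      omega
    obtain ⟨i, hi, hi3⟩ : ∃ i ∈ S, 3 ≤ availCard N A i := by
      by_contra! h
      refine (Nat.not_odd_iff_even.2 (hsum ▸ even_sum (availCard N A) fun i hi => ?_)) hodd
      have h2 := h i hi
      have h3 := h1 i hi
      have : availCard N A i = 0 ∨ availCard N A i = 2 := by omega
      rcases this with h | h <;> rw [h] <;> decide
    obtain ⟨c', A', hc', hA', hcard, hi', hj', hl⟩ := exists_kempe_change hc hA hi hj hi3 hj0
    have hss : ({l ∈ S | availCard N A' l = 0} : Finset C) ⊂ {l ∈ S | availCard N A l = 0} := by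
      rw [ssubset_iff_of_subset]
      · exact ⟨j, mem_filter.2 ⟨hj, hj0⟩, fun h => hj' (mem_filter.1 h).2⟩
      · intro l hl'
        rw [mem_filter] at hl' ⊢
        have hli : l ≠ i := fun h => hi' (h ▸ hl'.2)
        have hlj : l ≠ j := fun h => hj' (h ▸ hl'.2)
        exact ⟨hl'.1, by rw [← hl l hli hlj]; exact hl'.2⟩
    have := card_lt_card hss
    obtain ⟨c'', A'', h⟩ := ih hc' hA' (by simpa only [hcard] using hodd)
      (by simpa only [hcard] using hlt) (by omega)
    exact ⟨c'', A'', h.1, h.2.1, fun u => (h.2.2.1 u).trans (hcard u), h.2.2.2⟩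

/-- If at each vertex of `N` two colours are missing, except for one vertex where at least one
colour is missing, and if `N` has no more elements than there are colours, then the edge-colouring
may be changed so that distinct missing colours can be assigned to the vertices of `N`. -/
theorem exists_injOn_missing [Fintype V] [DecidableEq V] (n : ℕ) :
    ∀ {S : Finset C} {G : SimpleGraph V} {c : Sym2 V → C} {N : Finset V} {A : V → Finset C}
      (u₀ : V), #S = n → G.IsEdgeColoring S c → #N ≤ #S →
      (∀ u ∈ N, A u ⊆ S ∧ ∀ w, G.Adj u w → c s(u, w) ∉ A u) →
      (∀ u ∈ N, 1 ≤ #(A u) ∧ (u ≠ u₀ → 2 ≤ #(A u))) →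
      ∃ (c' : Sym2 V → C) (a : V → C), G.IsEdgeColoring S c' ∧ Set.InjOn a N ∧
        ∀ u ∈ N, a u ∈ S ∧ ∀ w, G.Adj u w → c' s(u, w) ≠ a u := by
  induction n with
  | zero =>
    intro S G c N A u₀ hS hc hN hA hA'
    have : N = ∅ := card_eq_zero.1 (by omega)
    subst this
    refine ⟨c, fun v => c s(v, v), hc, by simp, by simp⟩
  | succ n ih =>
    intro S G c N A u₀ hS hc hN hA hA'
    rcases N.eq_empty_or_nonempty with rfl | hne
    · exact ⟨c, fun v => c s(v, v), hc, by simp, by simp⟩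
    obtain ⟨u₁, hu₁, hu₁'⟩ : ∃ u₁ ∈ N, ∀ u ∈ N, u ≠ u₁ → 2 ≤ #(A u) := by
      by_cases h : u₀ ∈ N
      · exact ⟨u₀, h, fun u hu => (hA' u hu).2⟩
      · obtain ⟨u₁, hu₁⟩ := hne
        exact ⟨u₁, hu₁, fun u hu _ => (hA' u hu).2 fun h' => h (h' ▸ hu)⟩
    have hB : ∀ u, ∃ B ⊆ A u, u ∈ N → #B = if u = u₁ then 1 else 2 := by
      intro u
      by_cases hu : u ∈ N
      · have : (if u = u₁ then 1 else 2) ≤ #(A u) := by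
          split_ifs with h
          · exact (hA' u hu).1
          · exact hu₁' u hu h
        obtain ⟨B, hB, h⟩ := exists_subset_card_eq this
        exact ⟨B, hB, fun _ => h⟩
      · exact ⟨∅, empty_subset _, fun h => absurd h hu⟩
    choose B hBA hBc using hB
    -- The sets are cut down to sizes 1 and 2 so that the total is 2 * #N - 1: odd, and less than 2
    -- * #S.
    have hsum : ∑ u ∈ N, #(B u) = 1 + 2 * #(N.erase u₁) := by
      rw [← add_sum_erase _ _ hu₁, hBc u₁ hu₁, if_pos rfl, sum_const_nat (m := 2), mul_comm]
      intro u hu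
      rw [hBc u (mem_of_mem_erase hu), if_neg (ne_of_mem_erase hu)]
    have hcardN := card_erase_add_one hu₁
    obtain ⟨c', A', hc', hv', hcard', i, hiS, hi⟩ := exists_availCard_eq_one (N := N) _ hc
      (A := B) (fun u hu => ⟨(hBA u).trans (hA u hu).1, fun w hw h => (hA u hu).2 w hw (hBA u h)⟩)
      (by rw [hsum]; exact ⟨#(N.erase u₁), by ring⟩) (by rw [hsum]; omega) (Nat.lt_succ_self _)
    obtain ⟨u, hu⟩ := card_eq_one.1 hi
    have huN : u ∈ N ∧ i ∈ A' u := by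
      have : u ∈ ({u} : Finset V) := mem_singleton_self u
      rwa [← hu, mem_filter] at this
    have hiA : ∀ v ∈ N, v ≠ u → i ∉ A' v := by
      intro v hv hvu h
      have : v ∈ ({u ∈ N | i ∈ A' u} : Finset V) := mem_filter.2 ⟨hv, h⟩
      rw [hu, mem_singleton] at this
      exact hvu this
    -- The colour `i` is used up at `u`, its only possible place. Deleting `i`, its colour class and
    -- `u` costs no other vertex of `N` an available colour, so induction applies.
    let G' : SimpleGraph V :=
      { Adj := fun v w => G.Adj v w ∧ c' s(v, w) ≠ i
        symm := ⟨fun v w h => ⟨h.1.symm, by rw [Sym2.eq_swap]; exact h.2⟩⟩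
        loopless := ⟨fun v h => G.loopless.irrefl v h.1⟩ }
    have hc'' : G'.IsEdgeColoring (S.erase i) c' :=
      ⟨fun v w h => mem_erase.2 ⟨h.2, hc'.1 h.1⟩, fun v a b ha hb h => hc'.2 ha.1 hb.1 h⟩
    have hle := card_erase_add_one hiS
    have hle' := card_erase_add_one huN.1
    obtain ⟨d, a, hd, hinj, ha⟩ := ih (A := A') (N := N.erase u) u₁ (by omega) hc'' (by omega)
      (fun v hv => ⟨fun l hl => mem_erase.2
        ⟨fun h => hiA v (mem_of_mem_erase hv) (ne_of_mem_erase hv) (h ▸ hl),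
          (hv' v (mem_of_mem_erase hv)).1 hl⟩,
        fun w hw => (hv' v (mem_of_mem_erase hv)).2 w hw.1⟩)
      (fun v hv => by
        have := hBc v (mem_of_mem_erase hv)
        rw [hcard', this]
        split_ifs <;> simp_all)
    refine ⟨fun e => if c' e = i then i else d e, fun v => if v = u then i else a v,
      ⟨fun v w h => ?_, fun v x y hx hy h => ?_⟩, fun v hv w hw h => ?_, fun v hv => ?_⟩
    · dsimp only
      split_ifs with h'
      · exact hiS
      · exact mem_of_mem_erase (hd.1 (show G'.Adj v w from ⟨h, h'⟩))
    · dsimp only at h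
      split_ifs at h with h1 h2 h2
      · exact hc'.2 hx hy (h1.trans h2.symm)
      · exact absurd h.symm (ne_of_mem_erase (hd.1 (show G'.Adj v y from ⟨hy, h2⟩)))
      · exact absurd h (ne_of_mem_erase (hd.1 (show G'.Adj v x from ⟨hx, h1⟩)))
      · exact hd.2 (show G'.Adj v x from ⟨hx, h1⟩) (show G'.Adj v y from ⟨hy, h2⟩) h
    · rw [mem_coe] at hv hw
      dsimp only at h
      split_ifs at h with h1 h2 h2
      · exact h1.trans h2.symm
      · exact absurd h.symm (ne_of_mem_erase (ha w (mem_erase.2 ⟨h2, hw⟩)).1)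
      · exact absurd h (ne_of_mem_erase (ha v (mem_erase.2 ⟨h1, hv⟩)).1)
      · exact hinj (mem_coe.2 (mem_erase.2 ⟨h1, hv⟩)) (mem_coe.2 (mem_erase.2 ⟨h2, hw⟩)) h
    · dsimp only
      by_cases hvu : v = u
      · subst hvu
        rw [if_pos rfl]
        refine ⟨hiS, fun w hw => ?_⟩
        have : c' s(v, w) ≠ i := fun h => (hv' v hv).2 w hw (h ▸ huN.2)
        rw [if_neg this]
        exact ne_of_mem_erase (hd.1 (show G'.Adj v w from ⟨hw, this⟩))
      · rw [if_neg hvu]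
        have := ha v (mem_erase.2 ⟨hvu, hv⟩)
        refine ⟨mem_of_mem_erase this.1, fun w hw => ?_⟩
        split_ifs with h
        · exact (ne_of_mem_erase this.1).symm
        · exact this.2 w ⟨hw, h⟩

end Coloring

end SimpleGraph

namespace SimpleGraph

open Finset

/-! ### Edge-critical graphs -/

section Critical

variable {V C : Type*}

/-- A graph of maximum degree at most `k` that is minimal among the graphs without a proper
edge-colouring with `k` colours. -/
structure IsEdgeCritical [Fintype V] (H : SimpleGraph V) [DecidableRel H.Adj] (k : ℕ) : Prop where
  degree_le : ∀ v, H.degree v ≤ k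
  not_colorable : ¬∃ c, H.IsEdgeColoring (univ : Finset (Fin k)) c
  minimal : ∀ H' < H, ∃ c, H'.IsEdgeColoring (univ : Finset (Fin k)) c

theorem exists_isEdgeColoring_of_injOn [DecidableEq V] {H : SimpleGraph V} {x : V} {S : Finset C}
    {c : Sym2 V → C} (hc : (H.deleteIncidenceSet x).IsEdgeColoring S c) {a : V → C}
    (hinj : Set.InjOn a (H.neighborSet x))
    (ha : ∀ u, H.Adj x u → a u ∈ S ∧ ∀ w, (H.deleteIncidenceSet x).Adj u w → c s(u, w) ≠ a u) :
    ∃ c', H.IsEdgeColoring S c' := by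
  let c' : Sym2 V → C := Sym2.lift
    ⟨fun v w => if v = x then a w else if w = x then a v else c s(v, w), fun v w => by
      by_cases hv : v = x <;> by_cases hw : w = x <;> simp [hv, hw, Sym2.eq_swap]⟩
  have h1 : ∀ w, c' s(x, w) = a w := fun w => by simp [c']
  have h2 : ∀ v, c' s(v, x) = a v := fun v => by rw [Sym2.eq_swap, h1]
  have h3 : ∀ v w, v ≠ x → w ≠ x → c' s(v, w) = c s(v, w) := fun v w hv hw => by simp [c', hv, hw]
  have h4 : ∀ v w, H.Adj v w → v ≠ x → w ≠ x → (H.deleteIncidenceSet x).Adj v w :=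
    fun v w h hv hw => deleteIncidenceSet_adj.2 ⟨h, hv, hw⟩
  refine ⟨c', fun v w h => ?_, fun v y z hy hz h => ?_⟩
  · by_cases hv : v = x
    · subst hv; rw [h1]; exact (ha w h).1
    by_cases hw : w = x
    · subst hw; rw [h2]; exact (ha v h.symm).1
    rw [h3 v w hv hw]
    exact hc.1 (h4 v w h hv hw)
  · by_cases hv : v = x
    · subst hv; rw [h1, h1] at h; exact hinj hy hz h
    by_cases hy' : y = x <;> by_cases hz' : z = x
    · rw [hy', hz']
    · subst hy'
      rw [h2, h3 v z hv hz'] at h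
      exact absurd h.symm ((ha v hy.symm).2 z (h4 v z hz hv hz'))
    · subst hz'
      rw [h2, h3 v y hv hy'] at h
      exact absurd h ((ha v hz.symm).2 y (h4 v y hy hv hy'))
    · rw [h3 v y hv hy', h3 v z hv hz'] at h
      exact hc.2 (h4 v y hy hv hy') (h4 v z hz hv hz') h

variable [Fintype V] {H : SimpleGraph V} [DecidableRel H.Adj] {k : ℕ}

/-- The colours missing at the vertex `u` of `G` under `c`. -/
def missingColors [Fintype C] [DecidableEq C] (G : SimpleGraph V) [DecidableRel G.Adj]
    (c : Sym2 V → C) (u : V) : Finset C :=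
  univ \ (G.neighborFinset u).image fun w => c s(u, w)

theorem notMem_missingColors [Fintype C] [DecidableEq C] {G : SimpleGraph V} [DecidableRel G.Adj]
    {c : Sym2 V → C} {u w : V} (h : G.Adj u w) : c s(u, w) ∉ missingColors G c u := by
  simp only [missingColors, mem_sdiff, mem_univ, true_and, not_not]
  exact mem_image_of_mem (fun w => c s(u, w)) (by simpa using h)

theorem IsEdgeCritical.exists_deleteIncidenceSet (hH : H.IsEdgeCritical k) {x y : V}
    (h : H.Adj x y) :
    ∃ c, (H.deleteIncidenceSet x).IsEdgeColoring (univ : Finset (Fin k)) c := by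
  refine hH.minimal _ (lt_of_le_of_ne (deleteIncidenceSet_le H x) fun he => ?_)
  rw [← he, deleteIncidenceSet_adj] at h
  exact h.2.1 rfl

variable [DecidableEq V]

/-- Deleting the edges at `x` frees one colour at each neighbour. So a neighbour of degree at most
`k` misses at least one of `k` colours, and one of smaller degree at least two. -/
theorem le_card_missingColors [Fintype C] [DecidableEq C] {c : Sym2 V → C} {x u : V}
    (h : H.Adj x u) : Fintype.card C + 1 ≤
      #(missingColors (H.deleteIncidenceSet x) c u) + H.degree u := by
  have h1 : #((H.deleteIncidenceSet x).neighborFinset u) + 1 ≤ H.degree u := by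
    rw [← card_neighborFinset_eq_degree]
    refine card_lt_card (ssubset_iff_of_subset (fun w hw => ?_) |>.2 ⟨x, ?_, ?_⟩)
    · rw [mem_neighborFinset] at hw ⊢
      exact (deleteIncidenceSet_adj.1 hw).1
    · rw [mem_neighborFinset]; exact h.symm
    · rw [mem_neighborFinset, deleteIncidenceSet_adj]
      exact fun h => h.2.2 rfl
  have h2 : #(((H.deleteIncidenceSet x).neighborFinset u).image fun w => c s(u, w)) ≤
    #((H.deleteIncidenceSet x).neighborFinset u) := card_image_le
  have h3 := le_card_sdiff (((H.deleteIncidenceSet x).neighborFinset u).image fun w => c s(u, w))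
    (univ : Finset C)
  rw [card_univ] at h3
  rw [missingColors]
  omega

/-- In a critical graph, each nonisolated vertex has a neighbour of degree `k` other than a given
vertex. -/
theorem IsEdgeCritical.exists_adj_degree_eq (hH : H.IsEdgeCritical k) {x y : V} (h : H.Adj x y)
    (u₀ : V) : ∃ z, H.Adj x z ∧ z ≠ u₀ ∧ H.degree z = k := by
  by_contra! hno
  obtain ⟨c, hc⟩ := hH.exists_deleteIncidenceSet h
  obtain ⟨c', a, hc', hinj, ha⟩ := exists_injOn_missing k (N := H.neighborFinset x)
    (A := missingColors (H.deleteIncidenceSet x) c) u₀ (by simp) hc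
    (by simpa using hH.degree_le x)
    (fun u _ => ⟨subset_univ _, fun w hw => notMem_missingColors hw⟩)
    (fun u hu => by
      rw [mem_neighborFinset] at hu
      have h1 := le_card_missingColors (c := c) hu
      have h2 := hH.degree_le u
      rw [Fintype.card_fin] at h1
      refine ⟨by omega, fun hne => ?_⟩
      have := hno u hu hne
      omega)
  refine hH.not_colorable (exists_isEdgeColoring_of_injOn hc' (by simpa using hinj) fun u hu => ?_)
  exact ha u (by simpa using hu)

/-- In a critical graph, two vertices of degree two do not have the same neighbours. -/
theorem IsEdgeCritical.eq_of_adj_iff (hH : H.IsEdgeCritical k) {r r' a b : V} (hab : a ≠ b)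
    (hr : ∀ w, H.Adj r w ↔ w = a ∨ w = b) (hr' : ∀ w, H.Adj r' w ↔ w = a ∨ w = b) : r = r' := by
  by_contra hne
  have hra : H.Adj r a := (hr a).2 (.inl rfl)
  have hrb : H.Adj r b := (hr b).2 (.inr rfl)
  have hra' : H.Adj r' a := (hr' a).2 (.inl rfl)
  have hrb' : H.Adj r' b := (hr' b).2 (.inr rfl)
  obtain ⟨c, hc⟩ := hH.exists_deleteIncidenceSet hra'
  have hmiss : ∀ u, H.Adj r' u → ∃ m, ∀ w, (H.deleteIncidenceSet r').Adj u w → c s(u, w) ≠ m := by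
    intro u hu
    have h1 := le_card_missingColors (c := c) hu
    have h2 := hH.degree_le u
    rw [Fintype.card_fin] at h1
    obtain ⟨m, hm⟩ := card_pos.1 (show 0 < #(missingColors (H.deleteIncidenceSet r') c u) by omega)
    exact ⟨m, fun w hw h => notMem_missingColors hw (h ▸ hm)⟩
  have key : ∀ c' : Sym2 V → Fin k, (H.deleteIncidenceSet r').IsEdgeColoring univ c' →
      ∀ ma mb, ma ≠ mb → (∀ w, (H.deleteIncidenceSet r').Adj a w → c' s(a, w) ≠ ma) →
      (∀ w, (H.deleteIncidenceSet r').Adj b w → c' s(b, w) ≠ mb) → False := by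
    intro c' hc' ma mb hm ha hb
    refine hH.not_colorable (exists_isEdgeColoring_of_injOn hc'
      (a := fun u => if u = a then ma else mb) (fun u hu v hv h => ?_) fun u hu => ?_)
    · rcases (hr' u).1 hu with rfl | rfl <;> rcases (hr' v).1 hv with rfl | rfl
      · rfl
      · simp only [if_pos, if_neg hab.symm] at h; exact absurd h hm
      · simp only [if_pos, if_neg hab.symm] at h; exact absurd h.symm hm
      · rfl
    · rcases (hr' u).1 hu with rfl | rfl
      · simpa using ha
      · simpa [hab.symm] using hb
  obtain ⟨ma, hma⟩ := hmiss a hra'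
  obtain ⟨mb, hmb⟩ := hmiss b hrb'
  -- Different missing colours at `a` and `b` could be given to the edges at `r'`. If both are the
  -- same colour, it is missing at `r` too, because `r` has no neighbours but `a` and `b`.
  -- Recolouring the edge `ar` with it makes the old colour of `ar` missing at `a`, and the two
  -- colours then differ.
  by_cases hm : ma = mb
  swap
  · exact key c hc ma mb hm hma hmb
  subst hm
  have hdel : ∀ w, H.Adj r w → (H.deleteIncidenceSet r').Adj r w := fun w hw =>
    deleteIncidenceSet_adj.2 ⟨hw, hne, by
      rintro rfl
      rcases (hr w).1 hw with rfl | rfl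
      · exact H.loopless.irrefl _ hra'
      · exact H.loopless.irrefl _ hrb'⟩
  have hmr : ∀ w, H.Adj r w → c s(r, w) ≠ ma := by
    intro w hw
    rw [Sym2.eq_swap]
    rcases (hr w).1 hw with rfl | rfl
    · exact hma r (hdel _ hw).symm
    · exact hmb r (hdel _ hw).symm
  refine key (fun e => if e = s(a, r) then ma else c e) ⟨fun _ _ _ => mem_univ _,
    fun v x y hx hy h => ?_⟩ (c s(a, r)) ma (hma r (hdel a hra).symm) (fun w hw => ?_)
    fun w hw => ?_
  · have main : ∀ x y, (H.deleteIncidenceSet r').Adj v x → (H.deleteIncidenceSet r').Adj v y →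
        s(v, x) = s(a, r) → s(v, y) ≠ s(a, r) → ma ≠ c s(v, y) := by
      intro x y hx hy he _
      rcases Sym2.eq_iff.1 he with ⟨rfl, rfl⟩ | ⟨rfl, rfl⟩
      · exact (hma y hy).symm
      · exact (hmr y (deleteIncidenceSet_adj.1 hy).1).symm
    dsimp only at h
    split_ifs at h with h1 h2 h2
    · exact Sym2.congr_right.1 (h1.trans h2.symm)
    · exact absurd h (main x y hx hy h1 h2)
    · exact absurd h.symm (main y x hy hx h2 h1)
    · exact hc.2 hx hy h
  · split_ifs with h1
    · exact (hma r (hdel a hra).symm).symm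
    · exact fun h => h1 (by rw [hc.2 hw (hdel a hra).symm h])
  · have : s(b, w) ≠ s(a, r) := by
      intro h
      rcases Sym2.eq_iff.1 h with ⟨h, -⟩ | ⟨h, -⟩
      · exact hab h.symm
      · exact H.loopless.irrefl r (h ▸ hrb)
    rw [if_neg this]
    exact hmb w hw

end Critical

end SimpleGraph

namespace SimpleGraph

open Finset

/-! ### Menger's theorem by integral flows -/

section Menger

variable {V : Type*}

theorem Walk.exists_dart_of_mem_edges {G : SimpleGraph V} {u v : V} (p : G.Walk u v) {a b : V}
    (h : s(a, b) ∈ p.edges) :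
    ∃ d ∈ p.darts, (d.fst = a ∧ d.snd = b) ∨ (d.fst = b ∧ d.snd = a) := by
  obtain ⟨d, hd, he⟩ := List.mem_map.1 h
  refine ⟨d, hd, ?_⟩
  have : s(d.fst, d.snd) = s(a, b) := he
  simpa only [Sym2.eq_iff] using this

variable [DecidableEq V]

/-- The flow of value one along a walk. -/
def Walk.flow {G : SimpleGraph V} : ∀ {u v : V}, G.Walk u v → V → V → ℤ
  | _, _, .nil => fun _ _ => 0
  | u, _, .cons (v := w) _ p => fun a b =>
      p.flow a b + ((if a = u ∧ b = w then 1 else 0) - if a = w ∧ b = u then 1 else 0)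

variable {G : SimpleGraph V} {u v : V}

theorem Walk.flow_antisymm (p : G.Walk u v) (a b : V) : p.flow a b = -p.flow b a := by
  induction p with
  | nil => simp [flow]
  | cons h p ih =>
    simp only [flow]
    rw [ih]
    simp only [and_comm (a := b = _)]
    ring

theorem Walk.flow_eq_zero (p : G.Walk u v) {a b : V} (h : s(a, b) ∉ p.edges) : p.flow a b = 0 := by
  induction p with
  | nil => rfl
  | @cons u w v h' p ih =>
    rw [edges_cons, List.mem_cons, not_or] at h
    simp only [flow]
    rw [ih h.2, if_neg, if_neg]
    · rfl
    · rintro ⟨rfl, rfl⟩; exact h.1 Sym2.eq_swap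
    · rintro ⟨rfl, rfl⟩; exact h.1 rfl

theorem Walk.IsTrail.flow_eq_one {p : G.Walk u v} (hp : p.IsTrail) {d : G.Dart}
    (hd : d ∈ p.darts) : p.flow d.fst d.snd = 1 := by
  induction p with
  | nil => simp at hd
  | @cons u w v h' p ih =>
    rw [isTrail_cons] at hp
    rw [darts_cons, List.mem_cons] at hd
    simp only [flow]
    rcases hd with rfl | hd
    · rw [p.flow_eq_zero hp.2, if_pos ⟨rfl, rfl⟩, if_neg]
      · rfl
      · exact fun h => h'.ne h.1
    · have hmem : s(d.fst, d.snd) ∈ p.edges := List.mem_map_of_mem (f := Dart.edge) hd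
      rw [ih hp.1 hd, if_neg, if_neg]
      · rfl
      · rintro ⟨h1, h2⟩; rw [h1, h2, Sym2.eq_swap] at hmem; exact hp.2 hmem
      · rintro ⟨h1, h2⟩; rw [h1, h2] at hmem; exact hp.2 hmem

variable [Fintype V]

theorem Walk.flow_div (p : G.Walk u v) (a : V) :
    ∑ b, p.flow a b = (if a = u then 1 else 0) - if a = v then 1 else 0 := by
  induction p with
  | nil => simp [flow]
  | @cons u w v h p ih =>
    simp only [flow]
    rw [sum_add_distrib, ih, sum_sub_distrib]
    have h1 : ∀ x y : V, (∑ b, if a = x ∧ b = y then (1 : ℤ) else 0) = if a = x then 1 else 0 := by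
      intro x y
      by_cases hx : a = x <;> simp [hx]
    rw [h1, h1]
    ring

/-- The number of edges of `H` leaving the vertex set `S`. -/
def boundaryCard (H : SimpleGraph V) [DecidableRel H.Adj] (S : Finset V) : ℕ :=
  #{p : V × V | H.Adj p.1 p.2 ∧ p.1 ∈ S ∧ p.2 ∉ S}

/-- An integral flow of value `m` from `u` to `v` in which every edge has capacity one. -/
structure IsUnitFlow (H : SimpleGraph V) (u v : V) (m : ℕ) (g : V → V → ℤ) : Prop where
  antisymm : ∀ a b, g a b = -g b a
  le_one : ∀ a b, g a b ≤ 1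
  adj : ∀ a b, g a b ≠ 0 → H.Adj a b
  div : ∀ a, ∑ b, g a b = m * ((if a = u then 1 else 0) - if a = v then 1 else 0)

variable {H : SimpleGraph V} {m : ℕ} {g : V → V → ℤ}

/-- The flow across a cut. -/
theorem IsUnitFlow.sum_cut (hg : H.IsUnitFlow u v m g) {S : Finset V} (hu : u ∈ S) (hv : v ∉ S) :
    ∑ a ∈ S, ∑ b ∈ Sᶜ, g a b = m := by
  have h1 : ∑ a ∈ S, ∑ b, g a b = m := by
    simp only [hg.div]
    rw [← mul_sum, sum_sub_distrib]
    simp [hu, hv]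
  have h2 : ∑ a ∈ S, ∑ b ∈ S, g a b = 0 := by
    have : ∑ a ∈ S, ∑ b ∈ S, g a b = -∑ a ∈ S, ∑ b ∈ S, g a b := by
      conv_lhs => rw [sum_comm]
      rw [← sum_neg_distrib]
      refine sum_congr rfl fun a _ => ?_
      rw [← sum_neg_distrib]
      exact sum_congr rfl fun b _ => hg.antisymm b a
    omega
  have h3 : ∑ a ∈ S, ∑ b, g a b = ∑ a ∈ S, ∑ b ∈ S, g a b + ∑ a ∈ S, ∑ b ∈ Sᶜ, g a b := by
    rw [← sum_add_distrib]
    exact sum_congr rfl fun a _ => (sum_add_sum_compl S _).symm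
  omega

/-- Given a relation on adjacent vertices, either `v` can be reached from `u` along a path whose
steps satisfy it, or there is a vertex set separating `u` from `v` that no step leaves. -/
theorem exists_path_or_cut (H : SimpleGraph V) (R : V → V → Prop) (u v : V) :
    (∃ p : H.Walk u v, p.IsPath ∧ ∀ d ∈ p.darts, R d.fst d.snd) ∨
      ∃ S : Finset V, u ∈ S ∧ v ∉ S ∧ ∀ a ∈ S, ∀ b ∉ S, H.Adj a b → ¬R a b := by
  classical
  by_cases h : ∃ p : H.Walk u v, ∀ d ∈ p.darts, R d.fst d.snd
  · obtain ⟨p, hp⟩ := h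
    exact .inl ⟨p.bypass, p.bypass_isPath, fun d hd => hp d (p.darts_bypass_subset_darts hd)⟩
  · refine .inr ⟨univ.filter fun w => ∃ p : H.Walk u w, ∀ d ∈ p.darts, R d.fst d.snd, ?_,
      by simpa using h, ?_⟩
    · rw [mem_filter]
      exact ⟨mem_univ _, .nil, by simp⟩
    · intro a ha b hb hab hR
      rw [mem_filter] at ha hb
      obtain ⟨p, hp⟩ := ha.2
      refine hb ⟨mem_univ _, p.concat hab, fun d hd => ?_⟩
      rw [Walk.darts_concat, List.concat_eq_append, List.mem_append, List.mem_singleton] at hd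
      rcases hd with hd | rfl
      · exact hp d hd
      · exact hR

/-- Augmentation: since `g` is integral, `g ≤ 0` says that one more unit fits in that direction. -/
theorem IsUnitFlow.add_walk (hg : H.IsUnitFlow u v m g) {p : H.Walk u v} (hp : p.IsPath)
    (hR : ∀ d ∈ p.darts, g d.fst d.snd ≤ 0) :
    H.IsUnitFlow u v (m + 1) fun a b => g a b + p.flow a b where
  antisymm a b := by rw [hg.antisymm a b, p.flow_antisymm a b]; ring
  le_one a b := by
    by_cases h : s(a, b) ∈ p.edges
    · obtain ⟨d, hd, ⟨rfl, rfl⟩ | ⟨rfl, rfl⟩⟩ := p.exists_dart_of_mem_edges h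
      · have := hR d hd
        rw [hp.isTrail.flow_eq_one hd]
        omega
      · have := hg.le_one d.snd d.fst
        rw [p.flow_antisymm, hp.isTrail.flow_eq_one hd]
        omega
    · rw [p.flow_eq_zero h, add_zero]
      exact hg.le_one a b
  adj a b h := by
    by_cases h' : s(a, b) ∈ p.edges
    · exact p.adj_of_mem_edges h'
    · rw [p.flow_eq_zero h', add_zero] at h
      exact hg.adj a b h
  div a := by
    rw [sum_add_distrib, hg.div, p.flow_div]
    push_cast
    ring

/-- On the path the flow is exactly 1, being positive, integral and at most 1. Subtracting therefore
leaves zero there, so paths extracted later avoid these edges. -/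
theorem IsUnitFlow.sub_walk (hg : H.IsUnitFlow u v (m + 1) g) {p : H.Walk u v} (hp : p.IsPath)
    (hR : ∀ d ∈ p.darts, 0 < g d.fst d.snd) :
    H.IsUnitFlow u v m (fun a b => g a b - p.flow a b) ∧
      (∀ a b, s(a, b) ∈ p.edges → g a b - p.flow a b = 0) := by
  have key : ∀ a b, s(a, b) ∈ p.edges → g a b - p.flow a b = 0 := by
    intro a b h
    obtain ⟨d, hd, ⟨rfl, rfl⟩ | ⟨rfl, rfl⟩⟩ := p.exists_dart_of_mem_edges h
    · have := hR d hd
      have := hg.le_one d.fst d.snd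
      rw [hp.isTrail.flow_eq_one hd]
      omega
    · have := hR d hd
      have := hg.le_one d.fst d.snd
      rw [p.flow_antisymm, hp.isTrail.flow_eq_one hd, hg.antisymm]
      omega
  refine ⟨⟨fun a b => ?_, fun a b => ?_, fun a b h => ?_, fun a => ?_⟩, key⟩
  · rw [hg.antisymm a b, p.flow_antisymm a b]; ring
  · by_cases h : s(a, b) ∈ p.edges
    · rw [key a b h]; exact zero_le_one
    · rw [p.flow_eq_zero h, sub_zero]; exact hg.le_one a b
  · by_cases h' : s(a, b) ∈ p.edges
    · exact absurd (key a b h') h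
    · rw [p.flow_eq_zero h', sub_zero] at h
      exact hg.adj a b h
  · rw [sum_sub_distrib, hg.div, p.flow_div]
    push_cast
    ring

theorem exists_isUnitFlow [DecidableRel H.Adj] {k : ℕ}
    (hk : ∀ S : Finset V, u ∈ S → v ∉ S → k ≤ H.boundaryCard S) (hm : m ≤ k) :
    ∃ g, H.IsUnitFlow u v m g := by
  induction m with
  | zero => exact ⟨fun _ _ => 0, by simp, by simp, by simp, by simp⟩
  | succ m ih =>
    obtain ⟨g, hg⟩ := ih (by omega)
    rcases H.exists_path_or_cut (fun a b => g a b ≤ 0) u v with ⟨p, hp, hR⟩ | ⟨S, hu, hv, hS⟩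
    · exact ⟨_, hg.add_walk hp hR⟩
    · exfalso
      -- Without an augmenting path every edge leaving `S` is saturated, so the value `m` is the
      -- size of the cut, contrary to `m < k`.
      have h1 := hg.sum_cut hu hv
      have h2 : ∑ a ∈ S, ∑ b ∈ Sᶜ, g a b = H.boundaryCard S := by
        rw [boundaryCard, ← sum_product', natCast_card_filter]
        refine sum_subset_zero_on_sdiff (subset_univ _) (fun p hp => if_neg fun h => ?_)
          (fun p hp => ?_)
        · rw [mem_sdiff, mem_product, mem_compl] at hp
          exact hp.2 h.2
        · rw [mem_product, mem_compl] at hp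
          by_cases hadj : H.Adj p.1 p.2
          · rw [if_pos ⟨hadj, hp⟩]
            have := hS _ hp.1 _ hp.2 hadj
            have := hg.le_one p.1 p.2
            omega
          · rw [if_neg fun h => hadj h.1]
            by_contra h
            exact hadj (hg.adj _ _ h)
      have := hk S hu hv
      omega

theorem IsUnitFlow.exists_paths (hg : H.IsUnitFlow u v m g) :
    ∃ P : Fin m → H.Walk u v, (∀ i, (P i).IsPath) ∧
      (∀ i a b, s(a, b) ∈ (P i).edges → g a b ≠ 0) ∧
      Pairwise fun i j => (P i).edges.Disjoint (P j).edges := by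
  induction m generalizing g with
  | zero => exact ⟨fun i => i.elim0, fun i => i.elim0, fun i => i.elim0, fun i => i.elim0⟩
  | succ m ih =>
    rcases H.exists_path_or_cut (fun a b => 0 < g a b) u v with ⟨p, hp, hR⟩ | ⟨S, hu, hv, hS⟩
    · obtain ⟨hg', hzero⟩ := hg.sub_walk hp hR
      obtain ⟨P, hP, hPg, hPd⟩ := ih hg'
      have hdisj : ∀ i, p.edges.Disjoint (P i).edges := by
        intro i e he he'
        induction e with | _ a b => exact hPg i a b he' (hzero a b he)
      refine ⟨Fin.cons p P, fun i => ?_, fun i a b => ?_, fun i j => ?_⟩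
      · refine Fin.cases ?_ (fun i => ?_) i
        exacts [hp, hP i]
      · refine Fin.cases (fun h => ?_) (fun i h => ?_) i
        · rw [Fin.cons_zero] at h
          obtain ⟨d, hd, ⟨rfl, rfl⟩ | ⟨rfl, rfl⟩⟩ := p.exists_dart_of_mem_edges h
          · exact (hR d hd).ne'
          · rw [hg.antisymm]
            have := hR d hd
            omega
        · rw [Fin.cons_succ] at h
          have h1 := hPg i a b h
          rwa [p.flow_eq_zero fun h2 => hdisj i h2 h, sub_zero] at h1
      · refine Fin.cases ?_ (fun i => ?_) i <;> refine Fin.cases ?_ (fun j => ?_) j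
        · exact fun h => absurd rfl h
        · exact fun _ => hdisj j
        · exact fun _ => (hdisj i).symm
        · exact fun h => hPd fun h' => h (congrArg _ h')
    · exfalso
      have h1 := hg.sum_cut hu hv
      have h2 : ∑ a ∈ S, ∑ b ∈ Sᶜ, g a b ≤ 0 := by
        refine sum_nonpos fun a ha => sum_nonpos fun b hb => ?_
        rw [mem_compl] at hb
        by_contra h
        push Not at h
        exact hS a ha b hb (hg.adj a b h.ne') h
      push_cast at h1
      omega

/-- Menger's theorem for edge-disjoint paths. -/
theorem exists_edgeDisjoint_paths [DecidableRel H.Adj] {k : ℕ}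
    (hk : ∀ S : Finset V, u ∈ S → v ∉ S → k ≤ H.boundaryCard S) :
    ∃ P : Fin k → H.Walk u v, (∀ i, (P i).IsPath) ∧
      Pairwise fun i j => (P i).edges.Disjoint (P j).edges := by
  obtain ⟨g, hg⟩ := exists_isUnitFlow hk le_rfl
  obtain ⟨P, hP, -, hd⟩ := hg.exists_paths
  exact ⟨P, hP, hd⟩

end Menger

end SimpleGraph

namespace SimpleGraph

open Finset

/-! ### Uncrossing smallest cuts in a critical graph -/

section Cuts

variable {V : Type*} [Fintype V] [DecidableEq V] {H : SimpleGraph V} [DecidableRel H.Adj] {k : ℕ}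

theorem boundaryCard_compl (S : Finset V) : H.boundaryCard Sᶜ = H.boundaryCard S := by
  refine card_bij' (fun p _ => p.swap) (fun p _ => p.swap) ?_ ?_ (by simp) (by simp) <;>
  · intro p hp
    simp only [mem_filter, mem_univ, true_and, mem_compl, not_not, Prod.fst_swap,
      Prod.snd_swap] at hp ⊢
    exact ⟨hp.1.symm, hp.2.2, hp.2.1⟩

theorem boundaryCard_inter_add_union_le (S T : Finset V) :
    H.boundaryCard (S ∩ T) + H.boundaryCard (S ∪ T) ≤ H.boundaryCard S + H.boundaryCard T := by
  simp only [boundaryCard, card_filter]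
  rw [← sum_add_distrib, ← sum_add_distrib]
  refine sum_le_sum fun p _ => ?_
  by_cases h : H.Adj p.1 p.2 <;> by_cases h1 : p.1 ∈ S <;> by_cases h2 : p.1 ∈ T <;>
    by_cases h3 : p.2 ∈ S <;> by_cases h4 : p.2 ∈ T <;> simp [h, h1, h2, h3, h4]

/-- Submodularity for `S` and the complement of `T`, as a set and its complement have the same
boundary. -/
theorem boundaryCard_sdiff_add_sdiff_le (S T : Finset V) :
    H.boundaryCard (S \ T) + H.boundaryCard (T \ S) ≤ H.boundaryCard S + H.boundaryCard T := by
  have h := H.boundaryCard_inter_add_union_le S Tᶜ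
  rwa [boundaryCard_compl, ← sdiff_eq_inter_compl, ← boundaryCard_compl (S ∪ Tᶜ), compl_union,
    compl_compl, inter_comm Sᶜ, ← sdiff_eq_inter_compl] at h

/-- `S` is a smallest edge cut separating `a` from `b`. -/
structure IsMinCut (H : SimpleGraph V) [DecidableRel H.Adj] (S : Finset V) (a b : V) : Prop where
  mem : a ∈ S
  notMem : b ∉ S
  le : ∀ T, a ∈ T → b ∉ T → H.boundaryCard S ≤ H.boundaryCard T

theorem exists_isMinCut (H : SimpleGraph V) [DecidableRel H.Adj] {a b : V} (hab : a ≠ b) :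
    ∃ S, H.IsMinCut S a b := by
  obtain ⟨S, hS, hmin⟩ := exists_min_image ({S | a ∈ S ∧ b ∉ S} : Finset (Finset V))
    H.boundaryCard ⟨{a}, by simpa using hab.symm⟩
  rw [mem_filter] at hS
  exact ⟨S, hS.2.1, hS.2.2, fun T ha hb => hmin T (by simp [ha, hb])⟩

/-- Two vertices of a smallest cut `S` can be separated by a smallest cut smaller than `S`. -/
theorem IsMinCut.exists_ssubset {S : Finset V} {a b w : V} (hS : H.IsMinCut S a b) (hw : w ∈ S)
    (haw : a ≠ w) : ∃ T ⊂ S, H.IsMinCut T a w ∨ H.IsMinCut T w a := by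
  obtain ⟨T, hT⟩ := H.exists_isMinCut haw
  -- Uncrossing: if `b ∈ T`, the complement of `T \ S` still separates `a` from `b`, so `S \ T` is
  -- as small as `T`. If `b ∉ T`, then `S ∪ T` separates them and `S ∩ T` is as small as `T`.
  by_cases hb : b ∈ T
  · refine ⟨S \ T, Finset.ssubset_iff_subset_ne.2 ⟨sdiff_subset, fun h => ?_⟩, .inr
      ⟨mem_sdiff.2 ⟨hw, hT.notMem⟩, fun h => (mem_sdiff.1 h).2 hT.mem, fun T' h1 h2 => ?_⟩⟩
    · have := hS.mem
      rw [← h, mem_sdiff] at this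
      exact this.2 hT.mem
    · have h3 := H.boundaryCard_sdiff_add_sdiff_le S T
      have h4 := hS.le (T \ S)ᶜ (by simp [hS.mem]) (by simp [hb, hS.notMem])
      have h5 := hT.le T'ᶜ (by simpa using h2) (by simpa using h1)
      rw [boundaryCard_compl] at h4 h5
      omega
  · refine ⟨S ∩ T, Finset.ssubset_iff_subset_ne.2 ⟨inter_subset_left, fun h => ?_⟩, .inl
      ⟨mem_inter.2 ⟨hS.mem, hT.mem⟩, fun h => hT.notMem (mem_inter.1 h).2, fun T' h1 h2 => ?_⟩⟩
    · rw [← h, mem_inter] at hw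
      exact hT.notMem hw.2
    · have h3 := H.boundaryCard_inter_add_union_le S T
      have h4 := hS.le (S ∪ T) (mem_union_left _ hS.mem) (by simp [hb, hS.notMem])
      have h5 := hT.le T' h1 h2
      omega

/-- At least `k` edges leave a vertex set containing exactly one vertex of degree `k`. -/
theorem IsEdgeCritical.le_boundaryCard (hH : H.IsEdgeCritical k) {S : Finset V} {a : V}
    (ha : a ∈ S) (hak : H.degree a = k) (hS : ∀ w ∈ S, H.degree w = k → w = a) :
    k ≤ H.boundaryCard S := by
  have hz : ∀ s, ∃ z, H.Adj a s → H.Adj s z ∧ z ≠ a ∧ H.degree z = k := by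
    intro s
    by_cases h : H.Adj a s
    · obtain ⟨z, hz⟩ := hH.exists_adj_degree_eq h.symm a
      exact ⟨z, fun _ => hz⟩
    · exact ⟨a, fun h' => absurd h' h⟩
  choose z hz using hz
  rw [← hak, ← card_neighborFinset_eq_degree, boundaryCard]
  -- Each neighbour `s` of `a` accounts for one leaving edge: `as` if `s` is outside `S`, and
  -- otherwise an edge from `s` to a vertex of degree `k` other than `a`, which must lie outside
  -- `S`.
  refine card_le_card_of_injOn (fun s => if s ∈ S then (s, z s) else (a, s)) (fun s hs => ?_)
    fun s hs t ht h => ?_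
  · rw [coe_neighborFinset, mem_neighborSet] at hs
    rw [mem_coe, mem_filter]
    refine ⟨mem_univ _, ?_⟩
    dsimp only
    split_ifs with h
    · exact ⟨(hz s hs).1, h, fun h' => (hz s hs).2.1 (hS _ h' (hz s hs).2.2)⟩
    · exact ⟨hs, ha, h⟩
  · rw [coe_neighborFinset, mem_neighborSet] at hs ht
    dsimp only at h
    split_ifs at h
    · exact (Prod.ext_iff.1 h).1
    · exact absurd (Prod.ext_iff.1 h).1 hs.ne'
    · exact absurd (Prod.ext_iff.1 h).1 ht.ne
    · exact (Prod.ext_iff.1 h).2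

/-- A critical graph has two vertices of degree `k` joined by `k` edge-disjoint paths. -/
theorem IsEdgeCritical.exists_paths (hH : H.IsEdgeCritical k) (hk : k ≠ 0) :
    ∃ u v, u ≠ v ∧ H.degree u = k ∧ H.degree v = k ∧ ∃ P : Fin k → H.Walk u v,
      (∀ i, (P i).IsPath) ∧ Pairwise fun i j => (P i).edges.Disjoint (P j).edges := by
  suffices h : ∃ u v, u ≠ v ∧ H.degree u = k ∧ H.degree v = k ∧
      ∀ S : Finset V, u ∈ S → v ∉ S → k ≤ H.boundaryCard S by
    obtain ⟨u, v, huv, hu, hv, h⟩ := h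
    exact ⟨u, v, huv, hu, hv, exists_edgeDisjoint_paths h⟩
  by_contra! hno
  obtain ⟨x, y, hxy⟩ : ∃ x y, H.Adj x y := by
    by_contra! h
    refine hH.not_colorable ?_
    have : NeZero k := ⟨hk⟩
    exact ⟨fun _ => 0, fun v w h' => absurd h' (h v w), fun v x _ h' => absurd h' (h v x)⟩
  obtain ⟨z, hxz, -, hz⟩ := hH.exists_adj_degree_eq hxy x
  obtain ⟨z', -, hzz', hz'⟩ := hH.exists_adj_degree_eq hxy z
  obtain ⟨S₀, hS₀⟩ := H.exists_isMinCut hzz'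
  classical
  -- Minimality is in the number of vertices of the side `S`. A second vertex of degree `k` in `S`
  -- would give a smaller side by `IsMinCut.exists_ssubset`.
  obtain ⟨S, hS, hmin⟩ := exists_min_image
    ({S | ∃ a b, H.degree a = k ∧ H.degree b = k ∧ H.IsMinCut S a b} : Finset (Finset V)) card
    ⟨S₀, by simpa using ⟨z', hz', z, hz, hS₀⟩⟩
  obtain ⟨a, b, ha, hb, hab⟩ := (mem_filter.1 hS).2
  obtain ⟨w, hw, hwk, hwa⟩ : ∃ w ∈ S, H.degree w = k ∧ w ≠ a := by
    by_contra! h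
    have h1 := hH.le_boundaryCard hab.mem ha h
    obtain ⟨T, haT, hbT, hT⟩ := hno a b (fun h => hab.notMem (h ▸ hab.mem)) ha hb
    have := hab.le T haT hbT
    omega
  obtain ⟨T, hTS, hT⟩ := hab.exists_ssubset hw hwa.symm
  refine absurd (hmin T ?_) (not_le.2 (card_lt_card hTS))
  rw [mem_filter]
  rcases hT with hT | hT
  · exact ⟨mem_univ _, a, w, ha, hwk, hT⟩
  · exact ⟨mem_univ _, w, a, hwk, ha, hT⟩

end Cuts

end SimpleGraph

namespace SimpleGraph

/-! ### Constructing and transporting immersions -/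

section Immersion

variable {U U' V W : Type*}

/-- An injective homomorphism is an immersion whose paths are single edges. -/
theorem ContainsTotallyOddStrongImmersion.of_hom {K : SimpleGraph U} {G : SimpleGraph V}
    (f : K →g G) (hf : Function.Injective f) : G.ContainsTotallyOddStrongImmersion K := by
  refine ⟨⟨f, hf, fun h => (f.map_adj h).toWalk, fun h => ?_, fun h => rfl, fun h h' hne => ?_⟩,
    fun h w hw => ?_, fun h => ?_⟩
  · exact Walk.IsPath.of_adj _
  · intro e he he'
    rw [Adj.edges_toWalk, List.mem_singleton] at he he'
    refine hne (Sym2.map.injective hf ?_)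
    rw [Sym2.map_mk, Sym2.map_mk]
    exact he.symm.trans he'
  · simpa using hw
  · simp

/-- Immersions can be pulled back along embeddings of the immersed graph. -/
theorem ContainsTotallyOddStrongImmersion.comap {K : SimpleGraph U} {K' : SimpleGraph U'}
    {G : SimpleGraph V} (hG : G.ContainsTotallyOddStrongImmersion K) (f : K' →g K)
    (hf : Function.Injective f) : G.ContainsTotallyOddStrongImmersion K' := by
  obtain ⟨I, hs, ho⟩ := hG
  refine ⟨⟨I.terminal ∘ f, I.terminal_injective.comp hf, fun h => I.path (f.map_adj h),
    fun h => I.isPath _, fun h => I.path_symm _, fun h h' hne => I.edges_disjoint _ _ fun he => ?_⟩,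
    fun h w hw => hs _ _ hw, fun h => ho _⟩
  refine hne (Sym2.map.injective hf ?_)
  rwa [Sym2.map_mk, Sym2.map_mk]

/-- Immersions can be pushed forward along injective homomorphisms of the host graph. -/
theorem ContainsTotallyOddStrongImmersion.map {K : SimpleGraph U} {G : SimpleGraph V}
    {G' : SimpleGraph W} (hG : G.ContainsTotallyOddStrongImmersion K) (f : G →g G')
    (hf : Function.Injective f) : G'.ContainsTotallyOddStrongImmersion K := by
  obtain ⟨I, hs, ho⟩ := hG
  refine ⟨⟨f ∘ I.terminal, hf.comp I.terminal_injective, fun h => (I.path h).map f,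
    fun h => (I.isPath h).map hf, fun h => ?_, fun h h' hne => ?_⟩,
    fun {u v} h w hw => ?_, fun h => ?_⟩
  · rw [I.path_symm, Walk.reverse_map]
  · rw [Walk.edges_map, Walk.edges_map]
    exact (List.disjoint_map (Sym2.map.injective hf)) (I.edges_disjoint h h' hne)
  · change f _ ∈ _ at hw
    rw [Walk.support_map, List.mem_map] at hw
    obtain ⟨x, hx, he⟩ := hw
    rw [hf he] at hx
    exact (hs h w hx).imp (congrArg f) (congrArg f)
  · rw [Walk.length_map]; exact ho h

/-- A clique `e` and a vertex `f` joined to the members of `e` by edge-disjoint paths of odd length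
avoiding the other members of `e` form a totally odd strong immersion of a complete graph. -/
theorem ContainsTotallyOddStrongImmersion.of_clique_of_paths {G : SimpleGraph V} {n : ℕ}
    {e : Fin n → V} {f : V} (he : ∀ i j, i ≠ j → G.Adj (e i) (e j)) (hf : ∀ i, e i ≠ f)
    (Q : ∀ i, G.Walk (e i) f) (hQ : ∀ i, (Q i).IsPath) (hodd : ∀ i, Odd (Q i).length)
    (hQe : ∀ i j, e j ∈ (Q i).support → j = i)
    (hd : ∀ i j, i ≠ j → (Q i).edges.Disjoint (Q j).edges) :
    G.ContainsTotallyOddStrongImmersion (completeGraph (Fin (n + 1))) := by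
  have hinj : Function.Injective e := fun i j h => by
    by_contra hne
    exact (he i j hne).ne h
  suffices h : G.ContainsTotallyOddStrongImmersion (completeGraph (Option (Fin n))) by
    let g := finSuccEquiv n
    exact h.comap ⟨g, fun {a b} hab => fun h => hab (g.injective h)⟩ g.injective
  let t : Option (Fin n) → V := fun o => o.elim f e
  let path : ∀ {a b : Option (Fin n)}, (completeGraph (Option (Fin n))).Adj a b →
      G.Walk (t a) (t b)
    | none, none, h => absurd rfl h
    | some i, none, _ => Q i
    | none, some i, _ => (Q i).reverse
    | some i, some j, h => (he i j fun h' => h (congrArg some h')).toWalk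
  have hmix : ∀ i j l, i ≠ j → s(e i, e j) ∉ (Q l).edges := fun i j l hij h =>
    hij ((hQe l i ((Q l).fst_mem_support_of_mem_edges h)).trans
      (hQe l j ((Q l).snd_mem_support_of_mem_edges h)).symm)
  refine ⟨⟨t, ?_, path, ?_, ?_, ?_⟩, ?_, ?_⟩
  · rintro (_ | i) (_ | j) h
    · rfl
    · exact absurd h.symm (hf j)
    · exact absurd h (hf i)
    · exact congrArg some (hinj h)
  · rintro (_ | i) (_ | j) h
    · exact absurd rfl h
    · exact (hQ j).reverse
    · exact hQ i
    · exact Walk.IsPath.of_adj _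
  · rintro (_ | i) (_ | j) h
    · exact absurd rfl h
    · exact (Walk.reverse_reverse _).symm
    · rfl
    · rfl
  · have hs : ∀ {i j : Fin n} (h : G.Adj (e i) (e j)) x, x ∈ h.toWalk.edges → x = s(e i, e j) :=
      fun h x hx => by rwa [Adj.edges_toWalk, List.mem_singleton] at hx
    have hr : ∀ i x, x ∈ (Q i).reverse.edges → x ∈ (Q i).edges := fun i x hx => by
      rwa [Walk.edges_reverse, List.mem_reverse] at hx
    have hd' : ∀ i j x, x ∈ (Q i).edges → x ∈ (Q j).edges → i = j := fun i j x hx hx' => by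
      by_contra hne
      exact hd i j hne hx hx'
    rintro (_ | i) (_ | j) (_ | i') (_ | j') h h' hne x hx hx'
    · exact absurd rfl h
    · exact absurd rfl h
    · exact absurd rfl h
    · exact absurd rfl h
    · exact absurd rfl h'
    · exact hne (by rw [hd' _ _ x (hr _ _ hx) (hr _ _ hx')])
    · exact hne (by rw [hd' _ _ x (hr _ _ hx) hx', Sym2.eq_swap])
    · rw [hs _ x hx'] at hx
      exact hmix _ _ _ (fun h => h' (congrArg some h)) (hr _ _ hx)
    · exact absurd rfl h'
    · exact hne (by rw [hd' _ _ x hx (hr _ _ hx'), Sym2.eq_swap])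
    · exact hne (by rw [hd' _ _ x hx hx'])
    · rw [hs _ x hx'] at hx
      exact hmix _ _ _ (fun h => h' (congrArg some h)) hx
    · exact absurd rfl h'
    · rw [hs _ x hx] at hx'
      exact hmix _ _ _ (fun h' => h (congrArg some h')) (hr _ _ hx')
    · rw [hs _ x hx] at hx'
      exact hmix _ _ _ (fun h' => h (congrArg some h')) hx'
    · have := (hs _ x hx).symm.trans (hs _ x hx')
      refine hne (Sym2.map.injective (f := t) ?_ this)
      rintro (_ | i) (_ | j) h
      · rfl
      · exact absurd h.symm (hf j)
      · exact absurd h (hf i)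
      · exact congrArg some (hinj h)
  · rintro (_ | i) (_ | j) h (_ | l) hl
    · exact .inl rfl
    · exact absurd rfl h
    · exact .inl rfl
    · replace hl : e l ∈ (Q j).reverse.support := hl
      rw [Walk.support_reverse, List.mem_reverse] at hl
      exact .inr (congrArg e (hQe j l hl))
    · exact .inr rfl
    · exact .inl (congrArg e (hQe i l hl))
    · have : f ∈ (he i j fun h' => h (congrArg some h')).toWalk.support := hl
      simp only [Walk.support_cons, Walk.support_nil, List.mem_cons, List.not_mem_nil,
        or_false] at this
      rcases this with h | h
      · exact absurd h.symm (hf i)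
      · exact absurd h.symm (hf j)
    · have : e l ∈ (he i j fun h' => h (congrArg some h')).toWalk.support := hl
      have h' : e l = e i ∨ e l = e j := by simpa using this
      exact h'
  · rintro (_ | i) (_ | j) h
    · exact absurd rfl h
    · have : Odd (Q j).reverse.length := by
        rw [Walk.length_reverse]
        exact hodd j
      exact this
    · exact hodd i
    · exact odd_one

end Immersion

end SimpleGraph

namespace SimpleGraph

/-! ### Odd closed walks and the triangle -/

section OddCycle

variable {V : Type*} {G : SimpleGraph V}

/-- A shortest closed walk of odd length is a path apart from its first step. -/
theorem exists_cons_isPath_of_odd {u : V} (w : G.Walk u u) (hw : Odd w.length) :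
    ∃ (a b : V) (_ : G.Adj a b) (p : G.Walk b a), p.IsPath ∧ Even p.length := by
  obtain ⟨⟨a, q⟩, hq, hmin⟩ := WellFounded.has_min
    (measure fun x : Σ u, G.Walk u u => x.2.length).wf {x | Odd x.2.length} ⟨⟨u, w⟩, hw⟩
  replace hmin : ∀ {x} (r : G.Walk x x), Odd r.length → q.length ≤ r.length := fun {x} r hr =>
    not_lt.1 (hmin ⟨x, r⟩ hr)
  cases q with
  | nil => exact absurd hq (by simp)
  | @cons _ b _ h p =>
    replace hq : Odd (p.length + 1) := hq
    replace hmin : ∀ {x} (r : G.Walk x x), Odd r.length → p.length + 1 ≤ r.length := hmin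
    refine ⟨a, b, h, p, ?_, by rwa [Nat.odd_add_one, Nat.not_odd_iff_even] at hq⟩
    rw [← Walk.IsPath.getVert_injOn_iff]
    by_contra hinj
    obtain ⟨i, j, hij, hj, heq⟩ : ∃ i j, i < j ∧ j ≤ p.length ∧ p.getVert i = p.getVert j := by
      rw [Set.InjOn] at hinj
      push Not at hinj
      obtain ⟨i, hi, j, hj, heq, hne⟩ := hinj
      rcases lt_or_gt_of_ne hne with h | h
      exacts [⟨i, j, h, hj, heq⟩, ⟨j, i, h, hi, heq.symm⟩]
    -- A repeated vertex splits the closed walk into two shorter ones, whose lengths add up to an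
    -- odd number; one of them is odd.
    have h1 := hmin (((p.take j).drop i).copy (by rw [Walk.take_getVert, min_eq_right hij.le])
      heq.symm)
    have h2 := hmin (Walk.cons h ((p.take i).append ((p.drop j).copy heq.symm rfl)))
    simp only [Walk.length_copy, Walk.drop_length, Walk.take_length, Walk.length_cons,
      Walk.length_append] at h1 h2
    rcases Nat.even_or_odd (min j p.length - i) with he | ho
    · have : Odd (min i p.length + (p.length - j) + 1) := by
        rw [min_eq_left hj] at he
        rw [min_eq_left (hij.le.trans hj)]
        rw [Nat.even_iff] at he
        rw [Nat.odd_iff] at hq ⊢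
        omega
      have := h2 this
      omega
    · have := h1 ho
      omega

/-- A graph that is not two-colourable contains a triangle as a totally odd strong immersion. -/
theorem ContainsTotallyOddStrongImmersion.of_not_colorable_two (hG : ¬G.Colorable 2) :
    G.ContainsTotallyOddStrongImmersion (completeGraph (Fin 3)) := by
  rw [two_colorable_iff_forall_loop_even] at hG
  push Not at hG
  obtain ⟨u, w, hw⟩ := hG
  obtain ⟨a, b, h, p, hp, heven⟩ := exists_cons_isPath_of_odd w (by simpa using hw)
  cases p with
  | nil => exact absurd h (G.loopless.irrefl _)
  | @cons _ c _ h' q =>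
    rw [Walk.cons_isPath_iff] at hp
    rw [Walk.length_cons] at heven
    have hq : Odd q.length := by
      rw [Nat.even_add_one, Nat.not_even_iff_odd] at heven
      exact heven
    have hca : c ≠ a := by
      rintro rfl
      rw [Walk.length_eq_zero_iff.2 (Walk.isPath_iff_nil.1 hp.1)] at hq
      simp at hq
    have hba := h.ne.symm
    have hbc := h'.ne
    have hends : ∀ x ∈ h.symm.toWalk.support, x = b ∨ x = a := fun x hx => by simpa using hx
    let Q : ∀ i : Fin 2, G.Walk (![b, c] i) a := Fin.cons h.symm.toWalk (Fin.cons q finZeroElim)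
    refine of_clique_of_paths (n := 2) (e := ![b, c]) (f := a) ?_ ?_ Q ?_ ?_ ?_ ?_
    · intro i j hij
      fin_cases i <;> fin_cases j
      exacts [absurd rfl hij, h', h'.symm, absurd rfl hij]
    · intro i
      fin_cases i
      exacts [hba, hca]
    · intro i
      fin_cases i
      exacts [Walk.IsPath.of_adj _, hp.1]
    · intro i
      fin_cases i
      exacts [odd_one, hq]
    · intro i j hij
      fin_cases i <;> fin_cases j
      · rfl
      · rcases hends c hij with h | h
        exacts [absurd h.symm hbc, absurd h hca]
      · exact absurd hij hp.2
      · rfl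
    · have hd : h.symm.toWalk.edges.Disjoint q.edges := by
        intro e he he'
        rw [Adj.edges_toWalk, List.mem_singleton] at he
        subst he
        exact hp.2 (q.fst_mem_support_of_mem_edges he')
      intro i j hij
      fin_cases i <;> fin_cases j
      exacts [absurd rfl hij, hd, hd.symm, absurd rfl hij]

end OddCycle

end SimpleGraph

namespace SimpleGraph

/-! ### From edge-disjoint paths to paths in the line graph -/

section LineGraph

variable {V : Type*} {H : SimpleGraph V} {u v : V}

/-- A list of edges, consecutive ones meeting, is the list of vertices of a path of the line graph.
-/
theorem exists_lineGraph_isPath {R : Sym2 V → Sym2 V → Prop}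
    (hR : ∀ a b, R a b → ∃ x, x ∈ a ∧ x ∈ b) (l : List (Sym2 V)) (hl : ∀ e ∈ l, e ∈ H.edgeSet)
    (hnd : l.Nodup) (hch : l.IsChain R) {e f : H.edgeSet} (he : l.head? = some e.1)
    (hf : l.getLast? = some f.1) :
    ∃ Q : H.lineGraph.Walk e f, Q.IsPath ∧ Q.length + 1 = l.length ∧ (∀ x ∈ Q.support, x.1 ∈ l) ∧
      ∀ a b, s(a, b) ∈ Q.edges → R a.1 b.1 ∨ R b.1 a.1 := by
  induction l generalizing e with
  | nil => simp at he
  | cons y l ih =>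
    obtain rfl : y = e.1 := by simpa using he
    rcases l with _ | ⟨z, l⟩
    · obtain rfl : e = f := Subtype.ext (by simpa using hf)
      exact ⟨.nil, by simp, by simp, by simp, by simp⟩
    · rw [List.isChain_cons_cons] at hch
      rw [List.nodup_cons] at hnd
      obtain ⟨Q, hQ, hlen, hsup, hedge⟩ := ih (e := ⟨z, hl z (by simp)⟩)
        (fun x hx => hl x (List.mem_cons_of_mem _ hx)) hnd.2 hch.2 (by simp)
        (by rwa [List.getLast?_cons_cons] at hf)
      have hadj : H.lineGraph.Adj e ⟨z, hl z (by simp)⟩ := by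
        rw [lineGraph_adj_iff_exists]
        refine ⟨fun h => hnd.1 ?_, hR _ _ hch.1⟩
        rw [h]
        simp
      refine ⟨.cons hadj Q, (Walk.cons_isPath_iff _ _).2 ⟨hQ, fun h => hnd.1 (hsup _ h)⟩,
        by simp [Walk.length_cons, hlen], fun x hx => ?_, fun a b hab => ?_⟩
      · rw [Walk.support_cons, List.mem_cons] at hx
        rcases hx with rfl | hx
        · simp
        · exact List.mem_cons_of_mem _ (hsup x hx)
      · rw [Walk.edges_cons, List.mem_cons] at hab
        rcases hab with hab | hab
        · rcases Sym2.eq_iff.1 hab with ⟨rfl, rfl⟩ | ⟨rfl, rfl⟩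
          exacts [.inl hch.1, .inr hch.1]
        · exact hedge a b hab

theorem Walk.isChain_edges (p : H.Walk u v) :
    p.edges.IsChain fun a b => ∃ x, x ∈ a ∧ x ∈ b := by
  induction p with
  | nil => simp
  | @cons a b c h p ih =>
    rw [edges_cons]
    cases p with
    | nil => simp
    | cons h' p =>
      rw [edges_cons] at ih ⊢
      rw [List.isChain_cons_cons]
      exact ⟨⟨b, by simp, by simp⟩, ih⟩

theorem Walk.head?_edges (p : H.Walk u v) (hp : ¬p.Nil) : p.edges.head? = some s(u, p.snd) := by
  cases p with
  | nil => simp at hp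
  | cons h p => simp

/-- The edge `h` is a third edge at an interior vertex `x` of the walk `p`, not incident with the
first vertex of `p`. -/
structure Walk.IsDetour (p : H.Walk u v) (x : V) (h : Sym2 V) : Prop where
  exists_eq : ∃ l₁ h₁ h₂ l₂, p.edges = l₁ ++ h₁ :: h₂ :: l₂ ∧ x ∈ h₁ ∧ x ∈ h₂
  mem : x ∈ h
  mem_edgeSet : h ∈ H.edgeSet
  notMem_edges : h ∉ p.edges
  start_notMem : u ∉ h
  ne_end : x ≠ v

/-- The edge `a` follows or precedes the edge `b` when `p` is traversed in the line graph, taking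
the detour `h` at `x` if `W` holds. -/
def Walk.DetourStep (p : H.Walk u v) (W : Prop) (x : V) (h a b : Sym2 V) : Prop :=
  a ∈ p.edges ∧ b ∈ p.edges ∨ W ∧ a = h ∧ b ∈ p.edges ∧ x ∈ b

-- The detour edge goes between two consecutive edges of `p` at `x`. This changes the parity of the
-- length and keeps the first and the last edge.
open Classical in
theorem Walk.IsPath.exists_detour_list {p : H.Walk u v} (hp : p.IsPath) (W : Prop) {x : V}
    {h : Sym2 V} (hW : W → p.IsDetour x h) :
    ∃ l : List (Sym2 V), l.head? = p.edges.head? ∧ l.getLast? = p.edges.getLast? ∧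
      (l.length = p.length + if W then 1 else 0) ∧ l.Nodup ∧
      (∀ y ∈ l, y ∈ p.edges ∨ W ∧ y = h) ∧
      l.IsChain fun a b => (∃ x, x ∈ a ∧ x ∈ b) ∧
        (p.DetourStep W x h a b ∨ p.DetourStep W x h b a) := by
  have hch : p.edges.IsChain fun a b => (∃ x, x ∈ a ∧ x ∈ b) ∧
      (p.DetourStep W x h a b ∨ p.DetourStep W x h b a) :=
    p.isChain_edges.imp_of_mem_imp fun a b ha hb hab => ⟨hab, .inl (.inl ⟨ha, hb⟩)⟩
  by_cases hw : W
  · obtain ⟨⟨l₁, h₁, h₂, l₂, heq, hx₁, hx₂⟩, hx, -, hnot, -, -⟩ := hW hw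
    have hm₁ : h₁ ∈ p.edges := by rw [heq]; simp
    have hm₂ : h₂ ∈ p.edges := by rw [heq]; simp
    refine ⟨l₁ ++ h₁ :: h :: h₂ :: l₂, ?_, ?_, ?_, ?_, ?_, ?_⟩
    · rw [heq]; cases l₁ <;> simp
    · rw [heq]; simp
    · rw [if_pos hw, ← length_edges, heq]
      simp only [List.length_append, List.length_cons]
      omega
    · have : (l₁ ++ h₁ :: h :: h₂ :: l₂).Perm (h :: p.edges) := by
        rw [heq]
        refine (List.perm_middle.trans (List.Perm.cons _ List.perm_middle)).trans ?_
        exact (List.Perm.swap _ _ _).trans (List.Perm.cons _ List.perm_middle.symm)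
      rw [this.nodup_iff, List.nodup_cons]
      exact ⟨hnot, hp.isTrail.edges_nodup⟩
    · intro y hy
      rw [heq]
      simp only [List.mem_append, List.mem_cons] at hy ⊢
      tauto
    · rw [heq, List.isChain_append_cons_cons] at hch
      rw [List.isChain_append_cons_cons, List.isChain_cons_cons]
      exact ⟨hch.1, ⟨⟨x, hx₁, hx⟩, .inr (.inr ⟨hw, rfl, hm₁, hx₁⟩)⟩,
        ⟨⟨x, hx, hx₂⟩, .inl (.inr ⟨hw, rfl, hm₂, hx₂⟩)⟩, hch.2.2⟩
  · exact ⟨p.edges, rfl, rfl, by simp [hw], hp.isTrail.edges_nodup, fun y hy => .inl hy, hch⟩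

theorem Walk.IsPath.eq_of_mem_of_start_mem {p : H.Walk u v} (hp : p.IsPath) {y : Sym2 V}
    (hy : y ∈ p.edges) (hu : u ∈ y) : y = s(u, p.snd) := by
  obtain ⟨w, rfl⟩ := hu
  rw [hp.eq_snd_of_mem_edges hy]

/-- Edge-disjoint paths between `u` and `v`, their lengths having the right parity after suitable
detours, give a totally odd strong immersion of a complete graph in the line graph. -/
theorem ContainsTotallyOddStrongImmersion.of_edgeDisjoint_paths {k : ℕ} {P : Fin k → H.Walk u v}
    (huv : u ≠ v) (hP : ∀ i, (P i).IsPath)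
    (hd : Pairwise fun i j => (P i).edges.Disjoint (P j).edges) (j : Fin k) {f : Sym2 V}
    (hf : (P j).edges.getLast? = some f) (hvf : v ∈ f) (huf : u ∉ f)
    {W : Fin k → Prop} {x : Fin k → V} {h : Fin k → Sym2 V}
    (hW : ∀ i, W i → (P i).IsDetour (x i) (h i) ∧ h i ≠ f)
    (hx : ∀ i m, W i → W m → x i = x m → i = m)
    (hWj : W j ↔ Odd (P j).length) (hWi : ∀ i, i ≠ j → (W i ↔ Even (P i).length)) :
    H.lineGraph.ContainsTotallyOddStrongImmersion (completeGraph (Fin (k + 1))) := by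
  classical
  have hnil : ∀ i, ¬(P i).Nil := fun i hn => huv hn.eq
  have hfj : f ∈ (P j).edges := List.mem_of_getLast? hf
  have hfE : f ∈ H.edgeSet := (P j).edges_subset_edgeSet hfj
  have huniq : ∀ {i m y}, y ∈ (P i).edges → y ∈ (P m).edges → i = m := fun {i m y} hi hm => by
    by_contra hne
    exact hd hne hi hm
  have hmeet : ∀ {a b : Sym2 V} {x y : V}, a ≠ b → x ∈ a → y ∈ a → x ∈ b → y ∈ b → x = y := by
    intro a b x y hab hxa hya hxb hyb
    by_contra hne
    exact hab (((Sym2.mem_and_mem_iff hne).1 ⟨hxa, hya⟩).trans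
      ((Sym2.mem_and_mem_iff hne).1 ⟨hxb, hyb⟩).symm)
  -- `T i a b` covers the steps of the `i`-th path, up to orientation: along `P i`, to or from the
  -- detour edge, and between the last edge of `P i` and `f`. In every case `b` is an edge of `P i`.
  let T : Fin k → Sym2 V → Sym2 V → Prop := fun i a b =>
    (P i).DetourStep (W i) (x i) (h i) a b ∨ i ≠ j ∧ a = f ∧ b ∈ (P i).edges ∧ v ∈ b
  have hlist : ∀ i, ∃ l : List (Sym2 V), l.head? = some s(u, (P i).snd) ∧ l.getLast? = some f ∧
      Even l.length ∧ l.Nodup ∧ (∀ y ∈ l, y ∈ H.edgeSet ∧ (u ∈ y → y = s(u, (P i).snd))) ∧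
      l.IsChain fun a b => (∃ x, x ∈ a ∧ x ∈ b) ∧ (T i a b ∨ T i b a) := by
    intro i
    obtain ⟨l, hhead, hlast, hlen, hnd, hmem, hch⟩ :=
      (hP i).exists_detour_list (W i) fun hw => (hW i hw).1
    rw [(P i).head?_edges (hnil i)] at hhead
    have hmem' : ∀ y ∈ l, y ∈ H.edgeSet ∧ (u ∈ y → y = s(u, (P i).snd)) := by
      intro y hy
      rcases hmem y hy with hy | ⟨hw, rfl⟩
      · exact ⟨(P i).edges_subset_edgeSet hy, (hP i).eq_of_mem_of_start_mem hy⟩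
      · exact ⟨(hW i hw).1.mem_edgeSet, fun hu => absurd hu (hW i hw).1.start_notMem⟩
    have hch' : l.IsChain fun a b => (∃ x, x ∈ a ∧ x ∈ b) ∧ (T i a b ∨ T i b a) :=
      hch.imp fun a b hab => ⟨hab.1, hab.2.imp .inl .inl⟩
    by_cases hij : i = j
    · subst hij
      refine ⟨l, hhead, hlast.trans hf, ?_, hnd, hmem', hch'⟩
      rw [hlen]
      split_ifs with hw
      · exact (hWj.1 hw).add_one
      · exact Nat.not_odd_iff_even.1 fun ho => hw (hWj.2 ho)
    · have hfl : f ∉ l := fun hfl => by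
        rcases hmem f hfl with h' | ⟨hw, h'⟩
        · exact hij (huniq h' hfj)
        · exact (hW i hw).2 h'.symm
      refine ⟨l ++ [f], ?_, by simp, ?_, ?_, ?_, ?_⟩
      · rw [List.head?_append, hhead]; rfl
      · rw [List.length_append, hlen, List.length_singleton]
        split_ifs with hw
        · exact (((hWi i hij).1 hw).add_one).add_one
        · exact (Nat.not_even_iff_odd.1 fun ho => hw ((hWi i hij).2 ho)).add_one
      · rw [List.nodup_append]
        refine ⟨hnd, by simp, fun a ha b hb hab => hfl ?_⟩
        rw [List.mem_singleton] at hb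
        rwa [← hb, ← hab]
      · intro y hy
        rw [List.mem_append, List.mem_singleton] at hy
        rcases hy with hy | rfl
        · exact hmem' y hy
        · exact ⟨hfE, fun hu => absurd hu huf⟩
      · rw [List.isChain_append]
        refine ⟨hch', by simp, fun a ha b hb => ?_⟩
        obtain rfl : f = b := by simpa using hb
        rw [hlast, List.getLast?_eq_getLast_of_ne_nil (by simpa using hnil i),
          Walk.getLast_edges_eq_mk_penultimate_end, Option.mem_some_iff] at ha
        subst ha
        exact ⟨⟨v, by simp, hvf⟩, .inr (.inr ⟨hij, rfl,
          (P i).mk_penultimate_end_mem_edges (hnil i), by simp⟩)⟩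
  choose l hhead hlast heven hnd hmem hch using hlist
  have heE : ∀ i, s(u, (P i).snd) ∈ H.edgeSet := fun i => (P i).adj_snd (hnil i)
  have heP : ∀ i, s(u, (P i).snd) ∈ (P i).edges := fun i => (P i).mk_start_snd_mem_edges (hnil i)
  have hQ := fun i => exists_lineGraph_isPath (H := H) (fun a b hab => hab.1) (l i)
    (fun y hy => (hmem i y hy).1) (hnd i) (hch i) (e := ⟨_, heE i⟩) (f := ⟨f, hfE⟩)
    (hhead i) (hlast i)
  choose Q hQp hQlen hQsup hQedge using hQ
  -- A common step must be read in opposite directions, with `b` on `P i` and `a` on `P m`. Two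
  -- detour steps then force `x i = x m`, a detour step and a final step force the detour vertex to
  -- be `v`, and two final steps put `f` on `P i` although `i ≠ j`.
  have key : ∀ {i m a b}, i ≠ m → T i a b → T m a b ∨ T m b a → False := by
    intro i m a b him hi hm
    have hne : ∀ {y z}, y ∈ (P i).edges → z ∈ (P m).edges → y ≠ z := fun hy hz h' =>
      him (huniq hy (h' ▸ hz))
    rcases hi with (⟨ha, hb⟩ | ⟨hwi, rfl, hb, hxb⟩) | ⟨hij, rfl, hb, hvb⟩ <;>
    rcases hm with ((⟨ha', hb'⟩ | ⟨hwm, ha', hb', hxb'⟩) | ⟨hmj, ha', hb', hvb'⟩) |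
      ((⟨ha', hb'⟩ | ⟨hwm, ha', hb', hxb'⟩) | ⟨hmj, ha', hb', hvb'⟩)
    · exact hne ha ha' rfl
    · exact hne hb hb' rfl
    · exact hne hb hb' rfl
    · exact hne ha hb' rfl
    · exact hne ha hb' rfl
    · exact hne ha hb' rfl
    · exact hne hb hb' rfl
    · exact hne hb hb' rfl
    · exact hne hb hb' rfl
    · exact hne hb ha' rfl
    · refine him (hx i m hwi hwm (hmeet (hne hb hb') hxb ?_ (hW i hwi).1.mem hxb'))
      rw [ha']
      exact (hW m hwm).1.mem
    · subst ha'
      obtain rfl := huniq hb hfj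
      exact (hW i hwi).1.ne_end
        (hmeet (hne hb hb') hxb hvf (hW i hwi).1.mem hvb')
    · exact hne hb hb' rfl
    · exact hne hb hb' rfl
    · exact hne hb hb' rfl
    · exact hne hb ha' rfl
    · subst ha'
      obtain rfl := huniq hb' hfj
      exact (hW m hwm).1.ne_end
        (hmeet (hne hb hb').symm hxb' hvf (hW m hwm).1.mem hvb)
    · rw [ha'] at hb
      exact hij (huniq hb hfj)
  refine of_clique_of_paths (e := fun i => ⟨_, heE i⟩) (f := ⟨f, hfE⟩) (fun i m him => ?_)
    (fun i hi => ?_) Q hQp (fun i => ?_) (fun i m him => ?_) fun i m him => ?_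
  · rw [lineGraph_adj_iff_exists]
    refine ⟨fun h' => him (huniq (heP i) ?_), u, by simp, by simp⟩
    rw [Subtype.mk.injEq] at h'
    rw [h']
    exact heP m
  · rw [Subtype.mk.injEq] at hi
    exact huf (hi ▸ Sym2.mem_mk_left _ _)
  · have := heven i
    rw [← hQlen, Nat.even_add_one, Nat.not_even_iff_odd] at this
    exact this
  · have : s(u, (P m).snd) = s(u, (P i).snd) := (hmem i _ (hQsup i _ him)).2 (Sym2.mem_mk_left _ _)
    refine huniq (heP m) ?_
    rw [this]
    exact heP i
  · intro e he he'
    induction e with | _ a b =>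
    have h1 := hQedge i a b he
    have h2 := hQedge m a b he'
    have h1' : T i a b ∨ T i b a := h1.elim And.right fun h' => h'.2.symm
    have h2' : T m a b ∨ T m b a := h2.elim And.right fun h' => h'.2.symm
    rcases h1' with h1' | h1'
    · exact key him h1' h2'
    · exact key him h1' h2'.symm

end LineGraph

end SimpleGraph

namespace SimpleGraph

/-! ### Finding detour edges and exchanging tails -/

section PathSystem

variable {V : Type*} {H : SimpleGraph V} {u v : V} {k : ℕ}

theorem Walk.exists_edges_eq_append {p : H.Walk u v} {n : ℕ} (hn : n + 1 < p.length) :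
    ∃ l₁ l₂, p.edges = l₁ ++ s(p.getVert n, p.getVert (n + 1)) ::
      s(p.getVert (n + 1), p.getVert (n + 2)) :: l₂ := by
  have h1 : n < p.edges.length := by rw [Walk.length_edges]; omega
  have h2 : n + 1 < p.edges.length := by rwa [Walk.length_edges]
  refine ⟨p.edges.take n, p.edges.drop (n + 2), ?_⟩
  rw [← Walk.getElem_edges h1, ← Walk.getElem_edges h2, List.cons_getElem_drop_succ,
    List.cons_getElem_drop_succ, List.take_append_drop]

/-- The edges of a path at one of its interior vertices. -/
theorem Walk.IsPath.eq_or_eq_of_mk_getVert_mem_edges {p : H.Walk u v} (hp : p.IsPath) {n : ℕ}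
    (hn : n + 1 < p.length) {w : V} (hw : s(p.getVert (n + 1), w) ∈ p.edges) :
    w = p.getVert n ∨ w = p.getVert (n + 2) := by
  obtain ⟨l, hl, h⟩ := (p.mk_mem_edges_iff_exists).1 hw
  rcases Sym2.eq_iff.1 h with ⟨h1, h2⟩ | ⟨h1, h2⟩
  · have := hp.getVert_injOn (show l ≤ p.length from hl.le) (show n + 1 ≤ p.length from hn.le) h1
    subst this
    exact .inr h2.symm
  · have := hp.getVert_injOn (show l + 1 ≤ p.length from hl) (show n + 1 ≤ p.length from hn.le) h2
    obtain rfl : l = n := by omega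
    exact .inl h1.symm

/-- A family of edge-disjoint paths between two vertices. -/
structure IsPathSystem (P : Fin k → H.Walk u v) : Prop where
  isPath : ∀ i, (P i).IsPath
  disjoint : Pairwise fun i j => (P i).edges.Disjoint (P j).edges

namespace IsPathSystem

variable {P : Fin k → H.Walk u v}

theorem eq_of_mem (hP : IsPathSystem P) {i m : Fin k} {e : Sym2 V} (hi : e ∈ (P i).edges)
    (hm : e ∈ (P m).edges) : i = m := by
  by_contra hne
  exact hP.disjoint hne hi hm

theorem snd_injective (hP : IsPathSystem P) (huv : u ≠ v) :
    Function.Injective fun i => (P i).snd := by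
  intro i m h
  dsimp only at h
  have hnil : ∀ i, ¬(P i).Nil := fun i hn => huv hn.eq
  refine hP.eq_of_mem (Walk.mk_start_snd_mem_edges (hnil i)) ?_
  rw [h]
  exact Walk.mk_start_snd_mem_edges (hnil m)

/-- The `k` edge-disjoint paths leave `u` by `k` different edges, which are all the edges at `u`. -/
theorem exists_snd_eq [Fintype V] [DecidableRel H.Adj] (hP : IsPathSystem P) (huv : u ≠ v)
    (hu : H.degree u = k) {w : V} (hw : H.Adj u w) : ∃ m, (P m).snd = w := by
  classical
  have hsub : Finset.univ.image (fun i => (P i).snd) ⊆ H.neighborFinset u := by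
    intro x hx
    obtain ⟨i, -, rfl⟩ := Finset.mem_image.1 hx
    exact (H.mem_neighborFinset u _).2 (Walk.adj_snd fun hn => huv hn.eq)
  have := Finset.eq_of_subset_of_card_le hsub (by
    rw [Finset.card_image_of_injective _ (hP.snd_injective huv), card_neighborFinset_eq_degree, hu,
      Finset.card_univ, Fintype.card_fin])
  rw [← H.mem_neighborFinset, ← this] at hw
  obtain ⟨m, -, h⟩ := Finset.mem_image.1 hw
  exact ⟨m, h⟩

/-- A third edge at the interior vertex serves unless it contains `u` or is the last edge of `P j`.
In these cases it lies on another path of the system, whose other edge at that vertex serves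
instead, unless that path is `P j` of length two with this middle vertex; `hj` excludes this. -/
theorem exists_isDetour [Fintype V] [DecidableRel H.Adj] (hP : IsPathSystem P) (huv : u ≠ v)
    (hu : H.degree u = k) {i j : Fin k} {n : ℕ} (hn : n + 1 < (P i).length)
    (hdeg : 3 ≤ H.degree ((P i).getVert (n + 1)))
    (hj : i ≠ j → (P j).length = 2 → (P j).snd ≠ (P i).getVert (n + 1)) :
    ∃ h, (P i).IsDetour ((P i).getVert (n + 1)) h ∧ h ≠ s((P j).penultimate, v) := by
  classical
  obtain ⟨l₁, l₂, heq⟩ := Walk.exists_edges_eq_append hn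
  obtain ⟨w, hw, hwn⟩ : ∃ w, H.Adj ((P i).getVert (n + 1)) w ∧
      s((P i).getVert (n + 1), w) ∉ (P i).edges := by
    by_contra! h
    have hsub : H.neighborFinset ((P i).getVert (n + 1)) ⊆
        {(P i).getVert n, (P i).getVert (n + 2)} := fun w hw => by
      rw [Finset.mem_insert, Finset.mem_singleton]
      exact (hP.isPath i).eq_or_eq_of_mk_getVert_mem_edges hn
        (h w ((H.mem_neighborFinset _ _).1 hw))
    have := (Finset.card_le_card hsub).trans Finset.card_le_two
    rw [card_neighborFinset_eq_degree] at this
    omega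
  have hxu : (P i).getVert (n + 1) ≠ u := fun h => by
    rw [(hP.isPath i).getVert_eq_start_iff hn.le] at h
    omega
  have hxv : (P i).getVert (n + 1) ≠ v := fun h => by
    rw [(hP.isPath i).getVert_eq_end_iff hn.le] at h
    omega
  generalize (P i).getVert (n + 1) = x at *
  have hdet : ∀ {y}, y ≠ u → s(x, y) ∈ H.edgeSet → s(x, y) ∉ (P i).edges →
      (P i).IsDetour x s(x, y) := fun {y} hy he hn =>
    ⟨⟨l₁, _, _, l₂, heq, Sym2.mem_mk_right _ _, Sym2.mem_mk_left _ _⟩, Sym2.mem_mk_left _ _, he, hn,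
      by simp [hxu.symm, hy.symm], hxv⟩
  by_cases hwu : w = u
  · subst hwu
    obtain ⟨m, hm⟩ := hP.exists_snd_eq huv hu hw.symm
    have hnil : ¬(P m).Nil := fun hn => huv hn.eq
    have hfst := Walk.mk_start_snd_mem_edges hnil
    have hmi : m ≠ i := by
      rintro rfl
      rw [hm, Sym2.eq_swap] at hfst
      exact hwn hfst
    have hlen : 1 < (P m).length := by
      by_contra hlen
      refine hxv (hm ▸ ?_)
      exact (P m).getVert_of_length_le (not_lt.1 hlen)
    have he : s(x, (P m).getVert 2) ∈ (P m).edges :=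
      (P m).mk_mem_edges_iff_exists.2 ⟨1, hlen, by rw [← hm]⟩
    refine ⟨_, hdet (fun h => ?_) ((P m).edges_subset_edgeSet he)
      (fun h => hmi (hP.eq_of_mem he h)), fun h => ?_⟩
    · rw [(hP.isPath m).getVert_eq_start_iff hlen] at h
      omega
    · rw [h] at he
      have hmj : m = j := hP.eq_of_mem he
        (Walk.mk_penultimate_end_mem_edges fun hn => huv hn.eq)
      subst hmj
      refine hj hmi.symm ?_ hm
      rcases Sym2.eq_iff.1 h with ⟨-, h2⟩ | ⟨h1, -⟩
      · exact ((hP.isPath m).getVert_eq_end_iff hlen).1 h2 |>.symm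
      · exact absurd h1 hxv
  · by_cases hf : s(x, w) = s((P j).penultimate, v)
    · have hnil : ¬(P j).Nil := fun hn => huv hn.eq
      have hij : j ≠ i := by
        rintro rfl
        exact hwn (hf ▸ Walk.mk_penultimate_end_mem_edges hnil)
      have hx : (P j).getVert ((P j).length - 1) = x := by
        rcases Sym2.eq_iff.1 hf with ⟨h1, -⟩ | ⟨h1, -⟩
        · exact h1.symm
        · exact absurd h1 hxv
      obtain ⟨l, hl⟩ : ∃ l, (P j).length = l + 2 := by
        refine Nat.exists_eq_add_of_le' ?_
        by_contra! h
        have h0 : (P j).length - 1 = 0 := by omega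
        rw [h0, Walk.getVert_zero] at hx
        exact hxu hx.symm
      have hx' : (P j).getVert (l + 1) = x := by rw [← hx, hl]; rfl
      have he : s(x, (P j).getVert l) ∈ (P j).edges :=
        (P j).mk_mem_edges_iff_exists.2 ⟨l, by omega, by rw [← hx', Sym2.eq_swap]⟩
      refine ⟨_, hdet (fun h => ?_) ((P j).edges_subset_edgeSet he)
        (fun h => hij (hP.eq_of_mem he h)), fun h => ?_⟩
      · rw [(hP.isPath j).getVert_eq_start_iff (by omega)] at h
        subst h
        exact hj hij.symm hl hx'
      · rcases Sym2.eq_iff.1 h with ⟨-, h2⟩ | ⟨h1, -⟩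
        · rw [(hP.isPath j).getVert_eq_end_iff (by omega)] at h2
          omega
        · exact hxv h1
    · exact ⟨_, hdet hwu hw hwn, hf⟩

/-- Exchanging the ends of two paths of which one joins the start to `x` directly and the other one
through an intermediate vertex `r` of degree two. -/
theorem swap_tails (hP : IsPathSystem P) {i m : Fin k} (him : i ≠ m) {r x : V} (hr : H.Adj u r)
    (hrx : H.Adj r x) (hx : H.Adj u x) {p q : H.Walk x v} (hi : P i = .cons hr (.cons hrx p))
    (hm : P m = .cons hx q) (hrv : r ≠ v) (hr2 : ∀ w, H.Adj r w → w = u ∨ w = x) :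
    IsPathSystem (Function.update (Function.update P i (.cons hr (.cons hrx q))) m
      (.cons hx p)) := by
  have hdis : (P i).edges.Disjoint (P m).edges := hP.disjoint him
  have hpi := hP.isPath i
  have hpm := hP.isPath m
  have hti := hpi.isTrail.edges_nodup
  have htm := hpm.isTrail.edges_nodup
  have hdi : ∀ l, l ≠ i → (P l).edges.Disjoint (P i).edges := fun l hl => hP.disjoint hl
  have hdm : ∀ l, l ≠ m → (P l).edges.Disjoint (P m).edges := fun l hl => hP.disjoint hl
  rw [hi] at hpi hti
  rw [hm] at hpm htm
  rw [hi, hm] at hdis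
  -- The only edges at `r` are `ur` and `rx`, both on `P i`, so a path edge-disjoint from `P i`
  -- could meet `r` only as its end `v`.
  have hrq : r ∉ q.support := by
    intro h
    obtain h | ⟨e, he, w, rfl⟩ := Walk.mem_support_iff_exists_mem_edges.1 h
    · exact hrv h
    · refine hdis (a := s(r, w)) ?_ (by simp [he])
      rcases hr2 w (q.adj_of_mem_edges he) with rfl | rfl
      · rw [Sym2.eq_swap]; simp
      · simp
  have hnew : ∀ l, l ≠ i → l ≠ m → ((P l).edges.Disjoint (Walk.cons hr (.cons hrx q)).edges ∧
      (P l).edges.Disjoint (Walk.cons hx p).edges) := by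
    intro l hli hlm
    have h1 := hdi l hli
    have h2 := hdm l hlm
    rw [hi] at h1
    rw [hm] at h2
    simp only [Walk.edges_cons, List.disjoint_cons_right] at h1 h2 ⊢
    exact ⟨⟨h1.1, h1.2.1, h2.2⟩, h2.1, h1.2.2⟩
  have hsw : (Walk.cons hr (.cons hrx q)).edges.Disjoint (Walk.cons hx p).edges := by
    simp only [Walk.edges_cons, List.disjoint_cons_right, List.disjoint_cons_left, List.mem_cons,
      List.nodup_cons, not_or] at hti htm hdis ⊢
    exact ⟨⟨hdis.1.1, hdis.1.2.1, htm.1⟩, hti.1.2, hti.2.1, hdis.2.2.2.symm⟩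
  have hi' : Function.update (Function.update P i (.cons hr (.cons hrx q))) m (.cons hx p) i =
      .cons hr (.cons hrx q) := by
    rw [Function.update_of_ne him, Function.update_self]
  have hm' : Function.update (Function.update P i (.cons hr (.cons hrx q))) m (.cons hx p) m =
      .cons hx p := Function.update_self ..
  have hl' : ∀ l, l ≠ i → l ≠ m →
      Function.update (Function.update P i (.cons hr (.cons hrx q))) m (.cons hx p) l = P l :=
    fun l hli hlm => by rw [Function.update_of_ne hlm, Function.update_of_ne hli]
  generalize Function.update (Function.update P i (.cons hr (.cons hrx q))) m (.cons hx p) = P' at *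
  simp only [Walk.cons_isPath_iff, Walk.support_cons, List.mem_cons, not_or] at hpi hpm
  refine ⟨fun l => ?_, fun l l' hne => ?_⟩
  · by_cases hli : l = i
    · subst hli
      rw [hi']
      simp only [Walk.cons_isPath_iff, Walk.support_cons, List.mem_cons, not_or]
      exact ⟨⟨hpm.1, hrq⟩, hpi.2.1, hpm.2⟩
    by_cases hlm : l = m
    · subst hlm
      rw [hm']
      rw [Walk.cons_isPath_iff]
      exact ⟨hpi.1.1, hpi.2.2⟩
    rw [hl' l hli hlm]
    exact hP.isPath l
  · change (P' l).edges.Disjoint (P' l').edges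
    by_cases hli : l = i
    · subst hli
      by_cases hlm : l' = m
      · subst hlm
        rwa [hi', hm']
      rw [hi', hl' l' hne.symm hlm]
      exact (hnew l' hne.symm hlm).1.symm
    by_cases hlm : l = m
    · subst hlm
      by_cases hli' : l' = i
      · subst hli'
        rw [hi', hm']
        exact hsw.symm
      rw [hm', hl' l' hli' hne.symm]
      exact (hnew l' hli' hne.symm).2.symm
    rw [hl' l hli hlm]
    by_cases hli' : l' = i
    · subst hli'
      rw [hi']
      exact (hnew l hli hlm).1
    by_cases hlm' : l' = m
    · subst hlm'
      rw [hm']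
      exact (hnew l hli hlm).2
    rw [hl' l' hli' hlm']
    exact hP.disjoint hne

end IsPathSystem

end PathSystem
end SimpleGraph

namespace SimpleGraph

/-! ### Choosing the paths and their detour vertices -/

section CriticalPaths

variable {V : Type*} {H : SimpleGraph V} {u v : V} {k : ℕ}

theorem Walk.exists_eq_cons_of_snd_eq {p : H.Walk u v} (hp : ¬p.Nil) {x : V} (hx : p.snd = x) :
    ∃ (h : H.Adj u x) (q : H.Walk x v), p = .cons h q := by
  cases p with
  | nil => simp at hp
  | cons h q =>
    rw [Walk.snd_cons] at hx
    subst hx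
    exact ⟨h, q, rfl⟩

/-- A path system in which as few paths as possible have even length. -/
structure IsMinPathSystem (P : Fin k → H.Walk u v) : Prop extends IsPathSystem P where
  card_le : ∀ P' : Fin k → H.Walk u v, IsPathSystem P' →
    Finset.card {i | Even (P i).length} ≤ Finset.card {i | Even (P' i).length}

theorem IsPathSystem.exists_isMinPathSystem {P : Fin k → H.Walk u v} (hP : IsPathSystem P) :
    ∃ P : Fin k → H.Walk u v, IsMinPathSystem P := by
  obtain ⟨P, hP, hmin⟩ := (measure fun P : Fin k → H.Walk u v =>
    Finset.card {i | Even (P i).length}).wf.has_min {P | IsPathSystem P} ⟨P, hP⟩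
  exact ⟨P, hP, fun P' hP' => not_lt.1 (hmin P' hP')⟩

/-- Otherwise the paths run `u, r, x, …` and `u, x, …`. Exchanging their tails at `x` changes each
length by an odd amount, so both even paths become odd, contrary to minimality. -/
theorem IsMinPathSystem.snd_ne {P : Fin k → H.Walk u v} (hP : IsMinPathSystem P) (huv : u ≠ v)
    {i m : Fin k} (him : i ≠ m) (hi : Even (P i).length) (hm : Even (P m).length)
    (hlen : 2 ≤ (P i).length) (hrv : (P i).snd ≠ v)
    (hr : ∀ w, H.Adj (P i).snd w → w = u ∨ w = (P i).getVert 2) :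
    (P m).snd ≠ (P i).getVert 2 := by
  intro h
  obtain ⟨hx, q, hmq⟩ := Walk.exists_eq_cons_of_snd_eq (fun hn => huv hn.eq) h
  obtain ⟨hr', p', hip⟩ := Walk.exists_eq_cons_of_snd_eq (fun hn => huv hn.eq) (rfl : (P i).snd = _)
  have hp' : ¬p'.Nil := fun hn => by
    rw [← Walk.length_eq_zero_iff] at hn
    have := congrArg Walk.length hip
    rw [Walk.length_cons] at this
    omega
  have hp2 : p'.snd = (P i).getVert 2 := by
    have := congrArg (Walk.getVert · 2) hip
    exact this.symm
  obtain ⟨hrx, p, hpp⟩ := Walk.exists_eq_cons_of_snd_eq hp' hp2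
  rw [hpp] at hip
  have hsw := hP.swap_tails him hr' hrx hx hip hmq hrv hr
  refine absurd (hP.card_le _ hsw) (not_le.2 (Finset.card_lt_card ?_))
  rw [Finset.ssubset_iff_of_subset]
  · refine ⟨m, by simp [hm], ?_⟩
    have := congrArg Walk.length hip
    rw [Walk.length_cons, Walk.length_cons] at this
    rw [this, Nat.even_add_one] at hi
    simpa using hi
  · intro l hl
    rw [Finset.mem_filter] at hl ⊢
    refine ⟨Finset.mem_univ _, ?_⟩
    by_cases hlm : l = m
    · rwa [hlm]
    by_cases hli : l = i
    · rwa [hli]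
    have := hl.2
    rwa [Function.update_of_ne hlm, Function.update_of_ne hli] at this

variable [Fintype V] [DecidableEq V] [DecidableRel H.Adj]

theorem IsEdgeCritical.exists_ne_adj_degree_eq (hH : H.IsEdgeCritical k) {x y : V}
    (h : H.Adj x y) :
    ∃ z w, z ≠ w ∧ H.Adj x z ∧ H.Adj x w ∧ H.degree z = k ∧ H.degree w = k := by
  obtain ⟨z, hxz, -, hz⟩ := hH.exists_adj_degree_eq h x
  obtain ⟨w, hxw, hne, hw⟩ := hH.exists_adj_degree_eq h z
  exact ⟨z, w, hne.symm, hxz, hxw, hz, hw⟩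

/-- In a critical graph `r` has two neighbours of degree `k`; with degree less than three it has no
others. -/
theorem IsEdgeCritical.adj_iff_of_degree_lt_three (hH : H.IsEdgeCritical k) {r a b : V}
    (hr : H.degree r < 3) (ha : H.Adj r a) (hb : H.Adj r b) (hab : a ≠ b) :
    (∀ w, H.Adj r w ↔ w = a ∨ w = b) ∧ H.degree a = k ∧ H.degree b = k := by
  obtain ⟨z, w, hne, hz, hw, hzk, hwk⟩ := hH.exists_ne_adj_degree_eq ha
  have key : ∀ {a b : V}, H.Adj r a → H.Adj r b → a ≠ b → {a, b} = H.neighborFinset r := by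
    intro a b ha hb hab
    refine Finset.eq_of_subset_of_card_le ?_ ?_
    · intro x hx
      rw [Finset.mem_insert, Finset.mem_singleton] at hx
      rw [mem_neighborFinset]
      rcases hx with rfl | rfl <;> assumption
    · rw [Finset.card_pair hab, card_neighborFinset_eq_degree]
      omega
  have hiff : ∀ x, H.Adj r x ↔ x = a ∨ x = b := fun x => by
    rw [← mem_neighborFinset, ← key ha hb hab, Finset.mem_insert, Finset.mem_singleton]
  have hdeg : ∀ x, H.Adj r x → H.degree x = k := fun x hx => by
    rw [← mem_neighborFinset, ← key hz hw hne, Finset.mem_insert, Finset.mem_singleton] at hx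
    rcases hx with rfl | rfl <;> assumption
  exact ⟨hiff, hdeg a ha, hdeg b hb⟩

/-- The first vertex of degree at least three after the start of a path in a critical graph. -/
def Walk.detourVertex (p : H.Walk u v) : V :=
  if 3 ≤ H.degree p.snd then p.snd else p.getVert 2

/-- The path `p` has an interior vertex of degree at least three. -/
def Walk.HasDetour (p : H.Walk u v) : Prop :=
  2 ≤ p.length ∧ (H.degree p.snd < 3 → 3 ≤ p.length)

theorem IsEdgeCritical.adj_snd_iff (hH : H.IsEdgeCritical k) {p : H.Walk u v} (hp : p.IsPath)
    (hlen : 2 ≤ p.length) (hdeg : H.degree p.snd < 3) :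
    (∀ w, H.Adj p.snd w ↔ w = u ∨ w = p.getVert 2) ∧ H.degree (p.getVert 2) = k := by
  have h0 : H.Adj p.snd u := (by simpa using p.adj_getVert_succ (i := 0) (by omega) :
    H.Adj u p.snd).symm
  have h1 : H.Adj p.snd (p.getVert 2) := p.adj_getVert_succ (i := 1) (by omega)
  have hne : u ≠ p.getVert 2 := fun h => by
    have := (hp.getVert_eq_start_iff hlen).1 h.symm
    omega
  have := hH.adj_iff_of_degree_lt_three hdeg h0 h1 hne
  exact ⟨this.1, this.2.2⟩

theorem IsEdgeCritical.three_le_degree_detourVertex (hH : H.IsEdgeCritical k) (hk : 3 ≤ k)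
    {p : H.Walk u v} (hp : p.IsPath) (hlen : 2 ≤ p.length) : 3 ≤ H.degree p.detourVertex := by
  by_cases h : 3 ≤ H.degree p.snd
  · rwa [Walk.detourVertex, if_pos h]
  · rw [Walk.detourVertex, if_neg h, (hH.adj_snd_iff hp hlen (not_le.1 h)).2]
    exact hk

theorem IsEdgeCritical.exists_isDetour (hH : H.IsEdgeCritical k) (hk : 3 ≤ k) (huv : u ≠ v)
    (hu : H.degree u = k) {P : Fin k → H.Walk u v} (hP : IsPathSystem P) {i j : Fin k}
    (hi : (P i).HasDetour)
    (hj : i ≠ j → (P j).length = 2 → (P j).snd ≠ (P i).detourVertex) :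
    ∃ h, (P i).IsDetour (P i).detourVertex h ∧ h ≠ s((P j).penultimate, v) := by
  have h3 := hH.three_le_degree_detourVertex hk (hP.isPath i) hi.1
  by_cases h : 3 ≤ H.degree (P i).snd
  · rw [Walk.detourVertex, if_pos h] at hj h3 ⊢
    exact hP.exists_isDetour huv hu (n := 0) hi.1 h3 hj
  · rw [Walk.detourVertex, if_neg h] at hj h3 ⊢
    exact hP.exists_isDetour huv hu (n := 1) (hi.2 (not_le.1 h)) h3 hj

/-- Two second vertices coincide only on the same path; a second and a third vertex are kept apart
by `IsMinPathSystem.snd_ne`. If both are third vertices, the second vertices have degree two and the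
same neighbours, so they are equal by criticality. -/
theorem IsEdgeCritical.detourVertex_injOn (hH : H.IsEdgeCritical k) (hk : 3 ≤ k) (huv : u ≠ v)
    (hv : H.degree v = k) {P : Fin k → H.Walk u v} (hP : IsMinPathSystem P) {i m : Fin k}
    (hi : 2 ≤ (P i).length) (hm : 2 ≤ (P m).length) (hi2 : Even (P i).length)
    (hm2 : Even (P m).length) (h : (P i).detourVertex = (P m).detourVertex) : i = m := by
  by_contra hne
  have hsv : ∀ i, H.degree (P i).snd < 3 → (P i).snd ≠ v := fun i hi h => by
    rw [h] at hi
    omega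
  rw [Walk.detourVertex, Walk.detourVertex] at h
  split_ifs at h with h1 h2 h2
  · exact hne (hP.snd_injective huv h)
  · exact hP.snd_ne huv (Ne.symm hne) hm2 hi2 hm (hsv _ (not_le.1 h2))
      (fun w => ((hH.adj_snd_iff (hP.isPath m) hm (not_le.1 h2)).1 w).1) h
  · exact hP.snd_ne huv hne hi2 hm2 hi (hsv _ (not_le.1 h1))
      (fun w => ((hH.adj_snd_iff (hP.isPath i) hi (not_le.1 h1)).1 w).1) h.symm
  · have hi' := (hH.adj_snd_iff (hP.isPath i) hi (not_le.1 h1)).1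
    have hm' := (hH.adj_snd_iff (hP.isPath m) hm (not_le.1 h2)).1
    have hux : u ≠ (P i).getVert 2 := fun h => by
      have := ((hP.isPath i).getVert_eq_start_iff hi).1 h.symm
      omega
    rw [← h] at hm'
    exact hne (hP.snd_injective huv (hH.eq_of_adj_iff hux hi' hm'))

open Classical in
theorem IsEdgeCritical.contains_completeGraph (hH : H.IsEdgeCritical k) (hk : 3 ≤ k) :
    H.lineGraph.ContainsTotallyOddStrongImmersion (completeGraph (Fin (k + 1))) := by
  obtain ⟨u, v, huv, hu, hv, P₀, hP₀, hd₀⟩ := hH.exists_paths (by omega)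
  obtain ⟨P, hP⟩ := (IsPathSystem.mk hP₀ hd₀).exists_isMinPathSystem
  have hnil : ∀ i, ¬(P i).Nil := fun i hn => huv hn.eq
  have hone : ∀ i, (P i).length = 1 → (P i).snd = v := fun i hi => by
    exact (P i).getVert_of_length_le hi.le
  have hpos : ∀ i, (P i).length ≠ 0 := fun i hi => hnil i (Walk.length_eq_zero_iff.1 hi)
  have heven : ∀ {i}, Even (P i).length → 2 ≤ (P i).length := fun {i} hi => by
    have := hpos i
    obtain ⟨l, hl⟩ := hi
    omega
  suffices h : ∃ j, ∃ W : Fin k → Prop, 2 ≤ (P j).length ∧ (∀ i, W i → (P i).HasDetour) ∧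
      (∀ i, W i → i ≠ j → (P j).length = 2 → (P j).snd ≠ (P i).detourVertex) ∧
      (∀ i m, W i → W m → (P i).detourVertex = (P m).detourVertex → i = m) ∧
      (W j ↔ Odd (P j).length) ∧ ∀ i, i ≠ j → (W i ↔ Even (P i).length) by
    obtain ⟨j, W, hj, hW, hjW, hinj, hWj, hWi⟩ := h
    have hdet : ∀ i, ∃ h, W i → (P i).IsDetour (P i).detourVertex h ∧
        h ≠ s((P j).penultimate, v) := fun i => by
      by_cases hi : W i
      · obtain ⟨h, hh⟩ := hH.exists_isDetour hk huv hu hP.toIsPathSystem (hW i hi) (hjW i hi)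
        exact ⟨h, fun _ => hh⟩
      · exact ⟨s(u, v), fun h => absurd h hi⟩
    choose h hh using hdet
    refine .of_edgeDisjoint_paths huv hP.isPath hP.disjoint j (f := s((P j).penultimate, v)) ?_
      (Sym2.mem_mk_right _ _) ?_ hh hinj hWj hWi
    · have hne : (P j).edges ≠ [] := fun h => hpos j (by rw [← Walk.length_edges, h]; rfl)
      rw [List.getLast?_eq_getLast_of_ne_nil hne, Walk.getLast_edges_eq_mk_penultimate_end]
    · rw [Sym2.mem_iff, not_or]
      refine ⟨fun h => ?_, huv⟩
      have := ((hP.isPath j).getVert_eq_start_iff (Nat.sub_le _ _)).1 h.symm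
      omega
  by_cases hex : ∃ j, Even (P j).length
  -- An even path without room for a detour is `u, r, v` with `r` of degree two. There is at most
  -- one, since two would give two such vertices with the same neighbours. It becomes `P j`, the
  -- only even path that needs no detour.
  · obtain ⟨j, hj, hfix⟩ : ∃ j, Even (P j).length ∧
        ∀ i, i ≠ j → Even (P i).length → (P i).HasDetour := by
      by_cases hun : ∃ j, Even (P j).length ∧ ¬(P j).HasDetour
      · obtain ⟨j, hj, hjD⟩ := hun
        refine ⟨j, hj, fun i hij hi => ?_⟩
        by_contra hiD
        have key : ∀ {i}, Even (P i).length → ¬(P i).HasDetour →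
            ∀ w, H.Adj (P i).snd w ↔ w = u ∨ w = v := fun {i} hi hiD => by
          have h2 := heven hi
          rw [Walk.HasDetour] at hiD
          push Not at hiD
          have h3 := hiD h2
          have := (hH.adj_snd_iff (hP.isPath i) h2 h3.1).1
          rwa [(P i).getVert_of_length_le (by omega)] at this
        exact hij (hP.snd_injective huv (hH.eq_of_adj_iff huv (key hi hiD) (key hj hjD)))
      · push Not at hun
        obtain ⟨j, hj⟩ := hex
        exact ⟨j, hj, fun i _ => hun i⟩
    refine ⟨j, fun i => i ≠ j ∧ Even (P i).length, heven hj, fun i hi => hfix i hi.1 hi.2,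
      fun i hi hij hj2 hs => ?_, fun i m hi hm => ?_, ?_, fun i hi => by simp [hi]⟩
    -- If the middle vertex of `P j` were the detour vertex of `P i`, its degree would be at least
    -- three, so it would be the detour vertex of `P j` as well.
    · have h3 := hH.three_le_degree_detourVertex hk (hP.isPath i) (heven hi.2)
      have : (P j).detourVertex = (P j).snd := by
        rw [Walk.detourVertex, if_pos (hs ▸ h3)]
      exact hij (hH.detourVertex_injOn hk huv hv hP (heven hi.2) (heven hj) hi.2 hj
        (hs.symm.trans this.symm))
    · exact hH.detourVertex_injOn hk huv hv hP (heven hi.2) (heven hm.2) hi.2 hm.2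
    · simp [hj]
  -- If all paths are odd, only `P j` needs a detour. It must have length at least three, and such a
  -- path exists because only one path can be the single edge `uv`.
  · push Not at hex
    obtain ⟨j, hj⟩ : ∃ j, 3 ≤ (P j).length := by
      by_contra! h
      have h1 : ∀ i, (P i).length = 1 := fun i => by
        have := hex i
        have := h i
        obtain ⟨l, hl⟩ := Nat.not_even_iff_odd.1 (hex i)
        omega
      have := hP.snd_injective huv ((hone _ (h1 ⟨0, by omega⟩)).trans
        (hone _ (h1 ⟨1, by omega⟩)).symm)
      simp at this
    refine ⟨j, fun i => i = j, by omega, ?_, ?_, ?_, ?_, ?_⟩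
    · rintro i rfl
      exact ⟨by omega, fun _ => hj⟩
    · exact fun i hi hij => absurd hi hij
    · rintro i m rfl rfl _
      rfl
    · simpa using hex j
    · intro i hi
      simpa [hi] using hex i

end CriticalPaths

end SimpleGraph

namespace SimpleGraph

/-! ### Reduction to critical graphs -/

section Main

variable {V : Type*} {H : SimpleGraph V} {k : ℕ}

theorem colorable_lineGraph_of_isEdgeColoring {c : Sym2 V → Fin k}
    (hc : H.IsEdgeColoring Finset.univ c) : H.lineGraph.Colorable k := by
  refine ⟨Coloring.mk (fun e => c e) fun {e f} h he => ?_⟩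
  obtain ⟨e, hE⟩ := e
  obtain ⟨f, hF⟩ := f
  rw [lineGraph_adj_iff_exists] at h
  obtain ⟨hne, x, ⟨a, rfl⟩, ⟨b, rfl⟩⟩ := h
  have := hc.2 hE hF he
  subst this
  exact hne rfl

/-- The line graph of a subgraph maps to the line graph of the graph. -/
theorem exists_lineGraph_hom {H' : SimpleGraph V} (h : H' ≤ H) :
    ∃ f : H'.lineGraph →g H.lineGraph, Function.Injective f := by
  refine ⟨⟨fun e => ⟨e, edgeSet_mono h e.2⟩, fun {e f} hef => ?_⟩, fun e f hef => ?_⟩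
  · rw [lineGraph_adj_iff_exists] at hef ⊢
    exact ⟨fun h' => hef.1 (Subtype.ext (Subtype.mk.inj h')), hef.2⟩
  · exact Subtype.ext (Subtype.mk.inj hef)

variable [Fintype V] [DecidableRel H.Adj]

theorem contains_completeGraph_of_le_degree {v : V} (hk : k ≤ H.degree v) :
    H.lineGraph.ContainsTotallyOddStrongImmersion (completeGraph (Fin k)) := by
  rw [← card_neighborFinset_eq_degree, ← Fintype.card_fin k, ← Fintype.card_coe] at hk
  obtain ⟨g⟩ := Function.Embedding.nonempty_of_card_le hk
  have hg : ∀ i, H.Adj v (g i) := fun i => (H.mem_neighborFinset _ _).1 (g i).2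
  have hinj : Function.Injective fun i => (⟨s(v, g i), hg i⟩ : H.edgeSet) := fun i j h =>
    g.injective (Subtype.ext (Sym2.congr_right.1 (Subtype.mk.inj h)))
  refine .of_hom ⟨fun i => ⟨s(v, g i), hg i⟩, fun {i j} hij => ?_⟩ hinj
  rw [lineGraph_adj_iff_exists]
  exact ⟨fun h => hij (hinj h), v, by simp, by simp⟩

open Classical in
theorem exists_isEdgeCritical (hdeg : ∀ v, H.degree v ≤ k)
    (hH : ¬∃ c, H.IsEdgeColoring (Finset.univ : Finset (Fin k)) c) :
    ∃ H' ≤ H, H'.IsEdgeCritical k := by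
  obtain ⟨H', ⟨hle, hcol⟩, hmin⟩ := (wellFounded_lt (α := SimpleGraph V)).has_min
    {H' | H' ≤ H ∧ ¬∃ c, H'.IsEdgeColoring (Finset.univ : Finset (Fin k)) c} ⟨H, le_rfl, hH⟩
  refine ⟨H', hle, fun v => (degree_le_of_le hle).trans (hdeg v), hcol, fun K hK => ?_⟩
  by_contra h
  exact hmin K ⟨hK.le.trans hle, h⟩ hK

theorem contains_completeGraph_of_not_colorable (hdeg : ∀ v, H.degree v ≤ k) (hk : k ≠ 0)
    (hH : ¬H.lineGraph.Colorable k) :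
    H.lineGraph.ContainsTotallyOddStrongImmersion (completeGraph (Fin (k + 1))) := by
  classical
  obtain ⟨H', hle, hH'⟩ := exists_isEdgeCritical hdeg
    fun ⟨c, hc⟩ => hH (colorable_lineGraph_of_isEdgeColoring hc)
  have : NeZero k := ⟨hk⟩
  obtain ⟨x, y, hxy⟩ : ∃ x y, H'.Adj x y := by
    by_contra! h
    exact hH'.not_colorable
      ⟨fun _ => 0, fun v w h' => absurd h' (h v w), fun v x _ h' => absurd h' (h v x)⟩
  obtain ⟨z, w, hne, hz, hw, -, -⟩ := hH'.exists_ne_adj_degree_eq hxy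
  -- A nonisolated vertex of a critical graph has two neighbours, which rules out `k = 1`.
  have h2 : 2 ≤ k := by
    refine le_trans ?_ (hH'.degree_le x)
    rw [← card_neighborFinset_eq_degree, ← Finset.card_pair hne]
    refine Finset.card_le_card fun a ha => ?_
    rw [Finset.mem_insert, Finset.mem_singleton] at ha
    rw [mem_neighborFinset]
    rcases ha with rfl | rfl <;> assumption
  obtain rfl | h3 := h2.eq_or_lt
  · exact .of_not_colorable_two hH
  · obtain ⟨f, hf⟩ := exists_lineGraph_hom hle
    exact (hH'.contains_completeGraph h3).map f hf

end Main

end SimpleGraph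

theorem theorem2p2 {V : Type*} [Finite V] (H : SimpleGraph V) :
    ∃ t : ℕ, H.lineGraph.chromaticNumber = (t : ℕ∞) ∧
      H.lineGraph.ContainsTotallyOddStrongImmersion (SimpleGraph.completeGraph (Fin t)) := by
  classical
  have := Fintype.ofFinite V
  have := Fintype.ofFinite H.edgeSet
  obtain ⟨t, ht⟩ := ENat.ne_top_iff_exists.1
    (SimpleGraph.chromaticNumber_ne_top_iff_exists.2 ⟨_, H.lineGraph.colorable_of_fintype⟩)
  refine ⟨t, ht.symm, ?_⟩
  by_cases hle : ∃ v, t ≤ H.degree v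
  · obtain ⟨v, hv⟩ := hle
    exact SimpleGraph.contains_completeGraph_of_le_degree hv
  push Not at hle
  obtain _ | k := t
  · exact .of_hom ⟨fun i => i.elim0, fun {i} => i.elim0⟩ fun i => i.elim0
  have hcol : ¬H.lineGraph.Colorable k := fun h => by
    have := h.chromaticNumber_le
    rw [← ht, Nat.cast_le] at this
    omega
  refine SimpleGraph.contains_completeGraph_of_not_colorable (fun v => Nat.lt_succ_iff.1 (hle v))
    ?_ hcol
  -- With `k = 0` all degrees are zero, so the line graph has no vertices and is colourable with no
  -- colours.
  rintro rfl
  refine hcol ((SimpleGraph.colorable_zero_iff).2 ⟨fun e => ?_⟩)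
  obtain ⟨e, he⟩ := e
  induction e with | _ a b =>
  have h0 := hle a
  have h1 : 0 < H.degree a := (H.degree_pos_iff_exists_adj a).2 ⟨b, he⟩
  omega
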